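/- All functions below are complex-valued functions on $(0,\infty)$. Let $(\varphi*\psi)(x)=\int_0^x\varphi(x-\xi)\psi(\xi)\,d\xi$ denote the Laplace convolution, and let $$C_{-1}(0,\infty)=\{\varphi:\ \varphi(x)=x^p\varphi_1(x)\ (x>0)\ \text{for some real } p>-1 \text{ and some } \varphi_1\in C[0,\infty)\}.$$ For a function $f$ put $f^{<1>}=f$ and $f^{<n>}=f^{<n-1>}*f$ for $n\ge 2$ ($n$-fold convolution power). A pair $(\kappa,k)$ of functions that are locally integrable on $[0,\infty)$ is called a pair of Sonin kernels if $(\kappa*k)(x)=1$ for almost all $x>0$; it is called a pair of Sonin kernels in $C_{-1}(0,\infty)$ if $\kappa,k\in C_{-1}(0,\infty)$ and $(\kappa*k)(x)=1$ for every $x>0$. **Theorem.** Let $(\kappa_1,k_1)$ be a pair of Sonin kernels, let $f\in C_{-1}(0,\infty)$ be not identically zero, and let the power series $\sum_{n\ge0}a_nz^n$ and $\sum_{n\ge0}b_nz^n$ ($a_n,b_n\in\mathbb C$) have non-zero radii of convergence. Then the series $\sum_{n\ge1}a_nf^{<n>}(x)$ and $\sum_{n\ge1}b_nf^{<n>}(x)$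 converge for all $x>0$, the convolutions in $$\kappa=a_0\kappa_1+\kappa_1*\sum_{n=1}^{\infty}a_nf^{<n>},\qquad k=b_0k_1+k_1*\sum_{n=1}^{\infty}b_nf^{<n>}$$ exist almost everywhere on $(0,\infty)$, and $(\kappa,k)$ is a pair of Sonin kernels if and only if $$a_0b_0=1\quad\text{and}\quad\sum_{m=0}^{n}a_mb_{n-m}=0\ \text{ for all } n\ge1.$$ If $(\kappa_1,k_1)$ is a pair of Sonin kernels in $C_{-1}(0,\infty)$, then the convolutions exist at every $x>0$, and $(\kappa,k)$ is a pair of Sonin kernels in $C_{-1}(0,\infty)$ if and only if the same conditions hold. -/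

import Mathlib

open MeasureTheory Set

/-- The Laplace convolution `(φ * ψ)(x) = ∫₀ˣ φ(x - ξ) ψ(ξ) dξ`, used for `x > 0`. -/
noncomputable def lconv (φ ψ : ℝ → ℂ) (x : ℝ) : ℂ :=
  ∫ ξ in (0 : ℝ)..x, φ (x - ξ) * ψ ξ

/-- The integral defining `(φ * ψ)(x)` converges (absolutely). -/
def LconvExistsAt (φ ψ : ℝ → ℂ) (x : ℝ) : Prop :=
  IntervalIntegrable (fun ξ : ℝ => φ (x - ξ) * ψ ξ) volume 0 x

/-- The space `C₋₁(0,∞)`: on `(0,∞)`, `φ(x) = x ^ p φ₁(x)` with a real `p > -1` and `φ₁`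
continuous on `[0,∞)`. Values of `φ` outside `(0,∞)` are irrelevant. -/
def MemCNegOne (φ : ℝ → ℂ) : Prop :=
  ∃ (p : ℝ) (φ₁ : ℝ → ℂ), -1 < p ∧ ContinuousOn φ₁ (Ici 0) ∧
    ∀ x : ℝ, 0 < x → φ x = ((x ^ p : ℝ) : ℂ) * φ₁ x

/-- A pair of (locally integrable) Sonin kernels: `κ * k = 1` on `(0,∞)`. For locally integrable
kernels the convolution is only defined up to null sets, so the identity is one between
locally integrable functions, i.e. it holds almost everywhere. -/
def IsSoninPair (κ k : ℝ → ℂ) : Prop :=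
  LocallyIntegrableOn κ (Ici 0) volume ∧ LocallyIntegrableOn k (Ici 0) volume ∧
    ∀ᵐ x ∂(volume.restrict (Ioi (0 : ℝ))), LconvExistsAt κ k x ∧ lconv κ k x = 1

/-- A pair of Sonin kernels in `C₋₁(0,∞)`: here `(κ * k)(x) = 1` at every point `x > 0`. -/
def IsSoninPairCNegOne (κ k : ℝ → ℂ) : Prop :=
  MemCNegOne κ ∧ MemCNegOne k ∧
    ∀ x : ℝ, 0 < x → LconvExistsAt κ k x ∧ lconv κ k x = 1

/-- The convolution powers: `f^{<0>} = 1`, `f^{<1>} = f`, and `f^{<n>} = f * ⋯ * f` (`n` times). -/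
noncomputable def convPow (f : ℝ → ℂ) : ℕ → ℝ → ℂ
  | 0 => fun _ => 1
  | 1 => f
  | n + 2 => lconv (convPow f (n + 1)) f

/-- The convolution series `∑_{n ≥ 1} c_n f^{<n>}(x)`. -/
noncomputable def convSeries (c : ℕ → ℂ) (f : ℝ → ℂ) (x : ℝ) : ℂ :=
  ∑' n : ℕ, c (n + 1) * convPow f (n + 1) x

/-- The kernel `c₀ κ₁ + κ₁ * ∑_{n ≥ 1} c_n f^{<n>}`. -/
noncomputable def convSeriesKernel (κ₁ : ℝ → ℂ) (c : ℕ → ℂ) (f : ℝ → ℂ) (x : ℝ) : ℂ :=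
  c 0 * κ₁ x + lconv κ₁ (convSeries c f) x

/-! Formally `κ` is `κ₁` convolved with `a₀ δ + ∑ aₙ f^{<n>}`, and similarly for `k`. Such
expressions multiply like power series, so `κ * k` is `1 = κ₁ * k₁` convolved with `c₀ δ + ∑ cₙ
f^{<n>}`, where `c` is the Cauchy product of `a` and `b` (`lconv_convSeriesKernel`). The Sonin
condition becomes `c₀ + ∫₀ˣ ∑ cₙ f^{<n>} = 1`; differentiating gives `c₀ = 1` and `∑ cₙ f^{<n>} =
0`.

Convergence rests on `norm_lconv_le`: in the norm with weight `exp (r x) x ^ q`, convolution with a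
function dominated by `A x ^ q` has norm at most `A * convRate q r`, which tends to `0` as `r → ∞`.
Hence `f^{<n>}` decays faster than any geometric sequence, and homogeneous Volterra equations of the
second kind have only the zero solution.

It remains to see that a vanishing convolution series has vanishing coefficients. Factoring out the
lowest power with non-zero coefficient leaves a Volterra equation for that power of `f`, so the
power is zero. Convolution has no nilpotents: this reduces to `g * g = 0 → g = 0`, which follows
from Liouville's theorem and Fourier inversion. Identities proved almost everywhere hold everywhere
in `C₋₁(0,∞)` by continuity. -/

open scoped Convolution FourierTransform

/-! ### Local integrability and reduction to convolution on the line. -/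

/-- Integrability on every interval `(0,T]`. -/
def LocInt (φ : ℝ → ℂ) : Prop := ∀ T : ℝ, IntegrableOn φ (Ioc 0 T) volume

/-- The restriction of a function to `(0,T]`, extended by zero. -/
noncomputable def trunc (T : ℝ) (φ : ℝ → ℂ) : ℝ → ℂ := indicator (Ioc 0 T) φ

theorem locallyIntegrableOn_Ici_iff {φ : ℝ → ℂ} :
    LocallyIntegrableOn φ (Ici 0) volume ↔ LocInt φ := by
  rw [locallyIntegrableOn_iff isClosed_Ici.isLocallyClosed]
  constructor
  · intro h T
    exact (h (Icc 0 T) (fun x hx => hx.1) isCompact_Icc).mono_set Ioc_subset_Icc_self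
  · intro h k hk hkc
    obtain ⟨T, hT⟩ := hkc.bddAbove
    have : IntegrableOn φ (Icc 0 T) volume := integrableOn_Icc_iff_integrableOn_Ioc (by simp) |>.2 (h T)
    exact this.mono_set fun x hx => ⟨hk hx, hT hx⟩

theorem LocInt.integrable_trunc {φ : ℝ → ℂ} (h : LocInt φ) (T : ℝ) : Integrable (trunc T φ) :=
  (integrable_indicator_iff measurableSet_Ioc).2 (h T)

theorem trunc_of_nonpos {φ : ℝ → ℂ} {T x : ℝ} (hx : x ≤ 0) : trunc T φ x = 0 :=
  indicator_of_notMem (fun h => absurd h.1 hx.not_gt) _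

theorem trunc_eqOn {φ : ℝ → ℂ} {T x : ℝ} (hx : x ≤ T) : EqOn (trunc T φ) φ (Ioo 0 x) :=
  fun t ht => indicator_of_mem (show t ∈ Ioc 0 T from ⟨ht.1, ht.2.le.trans hx⟩) _

theorem ae_Ioi_of_forall_Ioc {P : ℝ → Prop} (h : ∀ T : ℝ, ∀ᵐ x ∂volume, x ∈ Ioc 0 T → P x) :
    ∀ᵐ x ∂(volume.restrict (Ioi (0 : ℝ))), P x := by
  rw [ae_restrict_iff' measurableSet_Ioi]
  have := ae_all_iff.2 fun n : ℕ => h n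
  filter_upwards [this] with x hx hx0
  obtain ⟨n, hn⟩ := exists_nat_ge x
  exact hx n ⟨hx0, hn⟩

/-- Vanishing on the nonpositive axis confines the whole-line integrand to `(0,x)`, so only the
values there matter. Stated for general `u`, `v` so that it covers both truncations and convolutions
of truncations. -/
theorem mul_comp_sub_left_eq_indicator {φ ψ u v : ℝ → ℂ} {x : ℝ}
    (hu : ∀ t ≤ 0, u t = 0) (hv : ∀ t ≤ 0, v t = 0)
    (hφ : EqOn u φ (Ioo 0 x)) (hψ : EqOn v ψ (Ioo 0 x)) :
    (fun t => u (x - t) * v t) = indicator (Ioo 0 x) (fun t => φ (x - t) * ψ t) := by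
  ext t
  by_cases ht : t ∈ Ioo 0 x
  · rw [indicator_of_mem ht, hψ ht, hφ ⟨by linarith [ht.2], by linarith [ht.1]⟩]
  · rw [indicator_of_notMem ht]
    rcases le_or_gt t 0 with h | h
    · rw [hv t h, mul_zero]
    · rw [hu (x - t) (by by_contra! h'; exact ht ⟨h, by linarith⟩), zero_mul]

theorem convolution_eq_lconv {φ ψ u v : ℝ → ℂ} {x : ℝ} (hx : 0 ≤ x)
    (hu : ∀ t ≤ 0, u t = 0) (hv : ∀ t ≤ 0, v t = 0)
    (hφ : EqOn u φ (Ioo 0 x)) (hψ : EqOn v ψ (Ioo 0 x)) :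
    (u ⋆[ContinuousLinearMap.mul ℂ ℂ] v) x = lconv φ ψ x := by
  have : (u ⋆[ContinuousLinearMap.mul ℂ ℂ] v) x = ∫ t, u (x - t) * v t :=
    convolution_mul_swap
  rw [this, mul_comp_sub_left_eq_indicator hu hv hφ hψ, integral_indicator measurableSet_Ioo, lconv,
    intervalIntegral.integral_of_le hx, integral_Ioc_eq_integral_Ioo]

theorem convolutionExistsAt_iff_lconvExistsAt {φ ψ u v : ℝ → ℂ} {x : ℝ} (hx : 0 ≤ x)
    (hu : ∀ t ≤ 0, u t = 0) (hv : ∀ t ≤ 0, v t = 0)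
    (hφ : EqOn u φ (Ioo 0 x)) (hψ : EqOn v ψ (Ioo 0 x)) :
    ConvolutionExistsAt u v x (ContinuousLinearMap.mul ℂ ℂ) volume ↔ LconvExistsAt φ ψ x := by
  rw [convolutionExistsAt_iff_integrable_swap, LconvExistsAt,
    intervalIntegrable_iff_integrableOn_Ioo_of_le hx,
    ← integrable_indicator_iff measurableSet_Ioo, ← mul_comp_sub_left_eq_indicator hu hv hφ hψ]
  rfl

theorem convolution_of_nonpos {u v : ℝ → ℂ} {x : ℝ} (hx : x ≤ 0)
    (hu : ∀ t ≤ 0, u t = 0) (hv : ∀ t ≤ 0, v t = 0) :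
    (u ⋆[ContinuousLinearMap.mul ℂ ℂ] v) x = 0 := by
  rw [convolution]
  refine integral_eq_zero_of_ae (Filter.Eventually.of_forall fun t => ?_)
  rcases le_or_gt t 0 with h | h
  · simp [hu t h]
  · simp [hv (x - t) (by linarith)]

/-! ### Algebra of the Laplace convolution. -/

theorem lconv_comm (φ ψ : ℝ → ℂ) (x : ℝ) : lconv φ ψ x = lconv ψ φ x := by
  have := intervalIntegral.integral_comp_sub_left (a := 0) (b := x)
    (fun t => φ (x - t) * ψ t) x
  simp only [sub_self, sub_zero, sub_sub_cancel] at this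
  rw [lconv, ← this, lconv]
  simp_rw [mul_comm]

theorem LconvExistsAt.symm {φ ψ : ℝ → ℂ} {x : ℝ} (h : LconvExistsAt φ ψ x) :
    LconvExistsAt ψ φ x := by
  have := (IntervalIntegrable.comp_sub_left h x).symm
  simp only [sub_self, sub_zero, sub_sub_cancel] at this
  rw [LconvExistsAt]
  simpa [mul_comm] using this

theorem lconv_congr {φ φ' ψ ψ' : ℝ → ℂ} {x : ℝ} (hx : 0 ≤ x)
    (hφ : EqOn φ φ' (Ioo 0 x)) (hψ : EqOn ψ ψ' (Ioo 0 x)) : lconv φ ψ x = lconv φ' ψ' x := by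
  simp only [lconv, intervalIntegral.integral_of_le hx, integral_Ioc_eq_integral_Ioo]
  refine setIntegral_congr_fun measurableSet_Ioo fun t ht => ?_
  simp only [hψ ht, hφ (show x - t ∈ Ioo 0 x from ⟨by linarith [ht.2], by linarith [ht.1]⟩)]

theorem trunc_congr_ae {φ φ' : ℝ → ℂ} (h : φ =ᵐ[volume.restrict (Ioi 0)] φ') (T : ℝ) :
    trunc T φ =ᵐ[volume] trunc T φ' := by
  have := (ae_restrict_iff' measurableSet_Ioi).1 h
  filter_upwards [this] with x hx
  by_cases hx' : x ∈ Ioc 0 T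
  · simp [trunc, indicator_of_mem hx', hx hx'.1]
  · simp [trunc, indicator_of_notMem hx']

theorem lconv_congr_ae {φ φ' ψ ψ' : ℝ → ℂ} (hφ : φ =ᵐ[volume.restrict (Ioi 0)] φ')
    (hψ : ψ =ᵐ[volume.restrict (Ioi 0)] ψ') {x : ℝ} (hx : 0 ≤ x) :
    lconv φ ψ x = lconv φ' ψ' x := by
  rw [← convolution_eq_lconv hx (fun _ => trunc_of_nonpos) (fun _ => trunc_of_nonpos)
      (trunc_eqOn le_rfl) (trunc_eqOn le_rfl),
    ← convolution_eq_lconv hx (fun _ => trunc_of_nonpos) (fun _ => trunc_of_nonpos)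
      (trunc_eqOn (φ := φ') le_rfl) (trunc_eqOn (φ := ψ') le_rfl),
    convolution_congr _ (trunc_congr_ae hφ x) (trunc_congr_ae hψ x)]

theorem LocInt.ae_lconvExistsAt {φ ψ : ℝ → ℂ} (hφ : LocInt φ) (hψ : LocInt ψ) :
    ∀ᵐ x ∂(volume.restrict (Ioi (0 : ℝ))), LconvExistsAt φ ψ x := by
  refine ae_Ioi_of_forall_Ioc fun T => ?_
  filter_upwards [(hφ.integrable_trunc T).ae_convolution_exists (ContinuousLinearMap.mul ℂ ℂ)
    (hψ.integrable_trunc T)] with x hx hxT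
  exact (convolutionExistsAt_iff_lconvExistsAt hxT.1.le (fun _ => trunc_of_nonpos)
    (fun _ => trunc_of_nonpos) (trunc_eqOn hxT.2) (trunc_eqOn hxT.2)).1 hx

theorem convolution_trunc_eqOn (φ ψ : ℝ → ℂ) (T : ℝ) :
    EqOn (trunc T φ ⋆[ContinuousLinearMap.mul ℂ ℂ] trunc T ψ) (lconv φ ψ) (Ioc 0 T) :=
  fun _ hx => convolution_eq_lconv hx.1.le (fun _ => trunc_of_nonpos)
    (fun _ => trunc_of_nonpos) (trunc_eqOn hx.2) (trunc_eqOn hx.2)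

theorem LocInt.lconv {φ ψ : ℝ → ℂ} (hφ : LocInt φ) (hψ : LocInt ψ) : LocInt (lconv φ ψ) := by
  intro T
  exact ((hφ.integrable_trunc T).integrable_convolution (ContinuousLinearMap.mul ℂ ℂ)
    (hψ.integrable_trunc T)).integrableOn.congr_fun (convolution_trunc_eqOn φ ψ T)
    measurableSet_Ioc

/-- Fubini for truncations to `(0,T]`: convolutions of truncations agree with Laplace convolutions
on `(0,T]`, and the value at `x ≤ T` depends only on what happens in `(0,x)`. -/
theorem lconv_assoc_ae {φ ψ χ : ℝ → ℂ} (hφ : LocInt φ) (hψ : LocInt ψ) (hχ : LocInt χ) :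
    lconv (lconv φ ψ) χ =ᵐ[volume.restrict (Ioi 0)] lconv φ (lconv ψ χ) := by
  refine ae_Ioi_of_forall_Ioc fun T => ?_
  have hu := hφ.integrable_trunc T
  have hv := hψ.integrable_trunc T
  have hw := hχ.integrable_trunc T
  -- Almost everywhere existence of the triple convolution of absolute values is what
  -- `convolution_assoc` needs for Fubini.
  filter_upwards [hu.norm.ae_convolution_exists (ContinuousLinearMap.mul ℝ ℝ)
    (hv.norm.integrable_convolution (ContinuousLinearMap.mul ℝ ℝ) hw.norm)] with x hx hxT
  have key := convolution_assoc (ContinuousLinearMap.mul ℂ ℂ) (ContinuousLinearMap.mul ℂ ℂ)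
    (ContinuousLinearMap.mul ℂ ℂ) (ContinuousLinearMap.mul ℂ ℂ)
    (fun a b c => by simp [mul_assoc]) (x₀ := x)
    hu.aestronglyMeasurable hv.aestronglyMeasurable hw.aestronglyMeasurable
    (hu.ae_convolution_exists _ hv) (hv.norm.ae_convolution_exists _ hw.norm) hx
  have hsub : Ioo 0 x ⊆ Ioc 0 T := fun t ht => ⟨ht.1, ht.2.le.trans hxT.2⟩
  rwa [convolution_eq_lconv hxT.1.le
      (fun t ht => convolution_of_nonpos ht (fun _ => trunc_of_nonpos) (fun _ => trunc_of_nonpos))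
      (fun _ => trunc_of_nonpos)
      ((convolution_trunc_eqOn φ ψ T).mono hsub) (trunc_eqOn hxT.2),
    convolution_eq_lconv hxT.1.le (fun _ => trunc_of_nonpos)
      (fun t ht => convolution_of_nonpos ht (fun _ => trunc_of_nonpos) (fun _ => trunc_of_nonpos))
      (trunc_eqOn hxT.2) ((convolution_trunc_eqOn ψ χ T).mono hsub)] at key

theorem LconvExistsAt.lconv_add_left {φ φ' ψ : ℝ → ℂ} {x : ℝ} (h : LconvExistsAt φ ψ x)
    (h' : LconvExistsAt φ' ψ x) :
    lconv (fun t => φ t + φ' t) ψ x = lconv φ ψ x + lconv φ' ψ x := by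
  simp only [lconv, add_mul]
  exact intervalIntegral.integral_add h h'

theorem LconvExistsAt.lconv_add_right {φ ψ ψ' : ℝ → ℂ} {x : ℝ} (h : LconvExistsAt φ ψ x)
    (h' : LconvExistsAt φ ψ' x) :
    lconv φ (fun t => ψ t + ψ' t) x = lconv φ ψ x + lconv φ ψ' x := by
  simp only [lconv, mul_add]
  exact intervalIntegral.integral_add h h'

theorem lconv_const_mul_left (c : ℂ) (φ ψ : ℝ → ℂ) (x : ℝ) :
    lconv (fun t => c * φ t) ψ x = c * lconv φ ψ x := by
  simp only [lconv, mul_assoc]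
  exact intervalIntegral.integral_const_mul _ _

theorem lconv_const_mul_right (c : ℂ) (φ ψ : ℝ → ℂ) (x : ℝ) :
    lconv φ (fun t => c * ψ t) x = c * lconv φ ψ x := by
  simp only [lconv, mul_left_comm _ c]
  exact intervalIntegral.integral_const_mul _ _

theorem LocInt.add {φ ψ : ℝ → ℂ} (hφ : LocInt φ) (hψ : LocInt ψ) :
    LocInt fun t => φ t + ψ t := fun T => (hφ T).add (hψ T)

theorem LocInt.const_mul {φ : ℝ → ℂ} (hφ : LocInt φ) (c : ℂ) :
    LocInt fun t => c * φ t := fun T => (hφ T).const_mul c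

/-! ### Power bounds and the space `C₋₁(0,∞)`. -/

/-- Domination by a multiple of `x ^ q` on every interval `(0,T]`. -/
def PowBound (q : ℝ) (φ : ℝ → ℂ) : Prop :=
  ∀ T : ℝ, ∃ A : ℝ, 0 ≤ A ∧ ∀ x ∈ Ioc 0 T, ‖φ x‖ ≤ A * x ^ q

theorem PowBound.mono {q q' : ℝ} {φ : ℝ → ℂ} (h : PowBound q' φ) (hq : q ≤ q') :
    PowBound q φ := by
  intro T
  obtain ⟨A, hA, hb⟩ := h T
  refine ⟨A * |T| ^ (q' - q), by positivity, fun x hx => (hb x hx).trans ?_⟩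
  have hT : x ≤ |T| := hx.2.trans (le_abs_self T)
  calc A * x ^ q' = A * x ^ (q' - q) * x ^ q := by
        rw [mul_assoc, ← Real.rpow_add hx.1, sub_add_cancel]
    _ ≤ A * |T| ^ (q' - q) * x ^ q := by
        have := Real.rpow_nonneg hx.1.le q
        have := Real.rpow_le_rpow hx.1.le hT (sub_nonneg.2 hq)
        gcongr

theorem MemCNegOne.continuousOn {φ : ℝ → ℂ} (h : MemCNegOne φ) : ContinuousOn φ (Ioi 0) := by
  obtain ⟨p, φ₁, -, hc, he⟩ := h
  refine ContinuousOn.congr (f := fun x => ((x ^ p : ℝ) : ℂ) * φ₁ x) ?_ he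
  refine ContinuousOn.mul ?_ (hc.mono Ioi_subset_Ici_self)
  refine Complex.continuous_ofReal.comp_continuousOn ?_
  exact fun x hx => (Real.continuousAt_rpow_const x p (Or.inl (ne_of_gt hx))).continuousWithinAt

theorem MemCNegOne.exists_powBound {φ : ℝ → ℂ} (h : MemCNegOne φ) :
    ∃ q : ℝ, -1 < q ∧ PowBound q φ := by
  obtain ⟨p, φ₁, hp, hc, he⟩ := h
  refine ⟨p, hp, fun T => ?_⟩
  obtain ⟨A, hA⟩ := isCompact_Icc.exists_bound_of_continuousOn (s := Icc 0 T)
    (hc.mono Icc_subset_Ici_self)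
  refine ⟨|A|, abs_nonneg A, fun x hx => ?_⟩
  have := (hA x ⟨hx.1.le, hx.2⟩).trans (le_abs_self A)
  have hx0 := Real.rpow_nonneg hx.1.le p
  rw [he x hx.1, norm_mul, Complex.norm_real, Real.norm_of_nonneg hx0, mul_comm]
  gcongr

/-- Giving up a little of the exponent, `-1 < p < q`, makes `x ^ (-p) φ(x)` of order `x ^ (q - p)`,
so it extends continuously by `0` at the origin. Together with the two preceding lemmas this
describes the space by continuity and a bound. -/
theorem memCNegOne_of_powBound {φ : ℝ → ℂ} {q : ℝ} (hq : -1 < q)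
    (hc : ContinuousOn φ (Ioi 0)) (hb : PowBound q φ) : MemCNegOne φ := by
  obtain ⟨p, hp, hpq⟩ := exists_between hq
  refine ⟨p, fun x => ((x ^ (-p) : ℝ) : ℂ) * (if 0 < x then φ x else 0), hp, ?_, fun x hx => ?_⟩
  · intro x hx
    rcases eq_or_lt_of_le (mem_Ici.1 hx) with rfl | hx
    · obtain ⟨A, hA, hbd⟩ := hb 1
      simp only [ContinuousWithinAt, lt_self_iff_false, if_false, mul_zero]
      have hlim : Filter.Tendsto (fun x : ℝ => A * x ^ (q - p)) (nhdsWithin 0 (Ici 0))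
          (nhds 0) := by
        have : ContinuousAt (fun x : ℝ => A * x ^ (q - p)) 0 :=
          (Real.continuousAt_rpow_const 0 (q - p) (Or.inr (by linarith))).const_mul A
        have h := this.tendsto
        rw [Real.zero_rpow (by linarith), mul_zero] at h
        exact h.mono_left nhdsWithin_le_nhds
      refine squeeze_zero_norm' ?_ hlim
      filter_upwards [self_mem_nhdsWithin,
        mem_nhdsWithin_of_mem_nhds (Iio_mem_nhds (zero_lt_one' ℝ))] with x hx hx1
      rcases eq_or_lt_of_le (mem_Ici.1 hx) with rfl | hx
      · simp only [lt_self_iff_false, if_false, mul_zero, norm_zero]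
        positivity
      · have h0 := Real.rpow_nonneg hx.le (-p)
        rw [if_pos hx, norm_mul, Complex.norm_real, Real.norm_of_nonneg h0]
        calc x ^ (-p) * ‖φ x‖ ≤ x ^ (-p) * (A * x ^ q) := by
              gcongr
              exact hbd x ⟨hx, hx1.le⟩
          _ = A * x ^ (q - p) := by
              rw [sub_eq_neg_add, Real.rpow_add hx]; ring
    · have h1 : ContinuousAt (fun x : ℝ => ((x ^ (-p) : ℝ) : ℂ)) x :=
        Complex.continuous_ofReal.continuousAt.comp
          (Real.continuousAt_rpow_const x (-p) (Or.inl hx.ne'))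
      have h2 : ContinuousAt (fun x => if 0 < x then φ x else 0) x := by
        refine (hc.continuousAt (Ioi_mem_nhds hx)).congr ?_
        filter_upwards [Ioi_mem_nhds hx] with y hy
        rw [if_pos (mem_Ioi.1 hy)]
      exact (h1.mul h2).continuousWithinAt
  · beta_reduce
    rw [if_pos hx, ← mul_assoc, ← Complex.ofReal_mul, ← Real.rpow_add hx]
    simp

/-- A common exponent for two functions in `C₋₁(0,∞)`. -/
theorem MemCNegOne.exists_powBound_pair {φ ψ : ℝ → ℂ} (h : MemCNegOne φ) (h' : MemCNegOne ψ) :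
    ∃ q : ℝ, -1 < q ∧ q ≤ 0 ∧ PowBound q φ ∧ PowBound q ψ := by
  obtain ⟨p, hp, hb⟩ := h.exists_powBound
  obtain ⟨p', hp', hb'⟩ := h'.exists_powBound
  -- The minimum with `0` makes `x ^ q` nonincreasing on `(0,∞)`, which the convolution estimates
  -- use.
  refine ⟨min (min p p') 0, by simp [hp, hp'], min_le_right _ _, hb.mono ?_, hb'.mono ?_⟩
  · exact (min_le_left _ _).trans (min_le_left _ _)
  · exact (min_le_left _ _).trans (min_le_right _ _)

/-! ### Weighted estimates for the convolution. -/

/-- Split at `x / 2`: the power with the larger argument is at most `(x / 2) ^ q`. On the right half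
also `x - ξ ≤ ξ`, which moves the exponential to the singular factor. -/
theorem rpow_mul_rpow_mul_exp_le {q r x ξ : ℝ} (hq : q ≤ 0) (hr : 0 ≤ r) (hξ : ξ ∈ Ioo 0 x) :
    (x - ξ) ^ q * ξ ^ q * Real.exp (-(r * ξ)) ≤ (x / 2) ^ q *
      (ξ ^ q * Real.exp (-(r * ξ)) + (x - ξ) ^ q * Real.exp (-(r * (x - ξ)))) := by
  have h0 := hξ.1
  have h1 : 0 < x - ξ := sub_pos.2 hξ.2
  have hx : 0 < x / 2 := by linarith
  have a0 := Real.rpow_nonneg h0.le q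
  have a1 := Real.rpow_nonneg h1.le q
  have a2 := Real.rpow_nonneg hx.le q
  rcases le_total ξ (x / 2) with h | h
  · have := Real.rpow_le_rpow_of_nonpos hx (show x / 2 ≤ x - ξ by linarith) hq
    calc (x - ξ) ^ q * ξ ^ q * Real.exp (-(r * ξ))
        ≤ (x / 2) ^ q * ξ ^ q * Real.exp (-(r * ξ)) := by gcongr
      _ ≤ _ := by
        rw [mul_add, mul_assoc]
        exact le_add_of_nonneg_right (by positivity)
  · have := Real.rpow_le_rpow_of_nonpos hx h hq
    calc (x - ξ) ^ q * ξ ^ q * Real.exp (-(r * ξ))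
        ≤ (x - ξ) ^ q * (x / 2) ^ q * Real.exp (-(r * (x - ξ))) := by
          gcongr
          linarith
      _ ≤ _ := by
        rw [mul_add, mul_comm ((x - ξ) ^ q), mul_assoc]
        exact le_add_of_nonneg_left (by positivity)

theorem rpow_mul_rpow_le {q x ξ : ℝ} (hq : q ≤ 0) (hξ : ξ ∈ Ioo 0 x) :
    (x - ξ) ^ q * ξ ^ q ≤ (x / 2) ^ q * (ξ ^ q + (x - ξ) ^ q) := by
  simpa using rpow_mul_rpow_mul_exp_le hq le_rfl hξ

theorem intervalIntegrable_rpow_add_rpow {q : ℝ} (hq : -1 < q) (c x : ℝ) :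
    IntervalIntegrable (fun ξ => c * (ξ ^ q + (x - ξ) ^ q)) volume 0 x := by
  refine IntervalIntegrable.const_mul ?_ c
  have h : IntervalIntegrable (fun ξ : ℝ => ξ ^ q) volume 0 x :=
    intervalIntegral.intervalIntegrable_rpow' hq
  have h' := (h.comp_sub_left x).symm
  simp only [sub_self, sub_zero] at h'
  exact h.add h'

/-- The norm of convolution with a function bounded by `x ^ q`, for the weight
`exp (r x) x ^ q`. -/
noncomputable def convRate (q r : ℝ) : ℝ :=
  2 * (1 / 2) ^ q * ((1 / r) ^ (q + 1) * Real.Gamma (q + 1))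

theorem convRate_nonneg {q r : ℝ} (hq : -1 < q) (hr : 0 < r) : 0 ≤ convRate q r := by
  have := Real.Gamma_pos_of_pos (show 0 < q + 1 by linarith)
  unfold convRate
  positivity

theorem tendsto_convRate {q : ℝ} (hq : -1 < q) :
    Filter.Tendsto (convRate q) Filter.atTop (nhds 0) := by
  have h1 : Filter.Tendsto (fun r : ℝ => (1 / r) ^ (q + 1)) Filter.atTop (nhds 0) := by
    have : ContinuousAt (fun x : ℝ => x ^ (q + 1)) 0 :=
      Real.continuousAt_rpow_const 0 (q + 1) (Or.inr (by linarith))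
    have h := this.tendsto
    rw [Real.zero_rpow (by linarith)] at h
    simp only [one_div]
    exact h.comp tendsto_inv_atTop_zero
  have := (h1.mul_const (Real.Gamma (q + 1))).const_mul (2 * (1 / 2) ^ q)
  simp only [mul_zero, zero_mul] at this
  exact this

/-- Writing `exp (r (x - ξ)) = exp (r x) exp (-r ξ)` pulls the weight out. The midpoint bound then
leaves two equal integrals of `s ^ q exp (-r s)` over `(0,x)`, each at most the Gamma integral over
`(0,∞)`. -/
theorem norm_lconv_le {φ ψ : ℝ → ℂ} {q r A M x : ℝ} (hq : -1 < q) (hq0 : q ≤ 0) (hr : 0 < r)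
    (hx : 0 < x) (hA : 0 ≤ A)
    (hφ : ∀ ξ ∈ Ioo 0 x, ‖φ ξ‖ ≤ A * (Real.exp (r * ξ) * ξ ^ q))
    (hψ : ∀ ξ ∈ Ioo 0 x, ‖ψ ξ‖ ≤ M * ξ ^ q) :
    ‖lconv φ ψ x‖ ≤ A * M * convRate q r * (Real.exp (r * x) * x ^ q) := by
  set w : ℝ → ℝ := fun s => s ^ q * Real.exp (-(r * s)) with hw
  have hM : 0 ≤ M := by
    have h2 : x / 2 ∈ Ioo 0 x := ⟨by linarith, by linarith⟩
    exact nonneg_of_mul_nonneg_left ((norm_nonneg _).trans (hψ _ h2)) (Real.rpow_pos_of_pos h2.1 q)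
  have hI : IntegrableOn w (Ioi 0) := by
    have := integrableOn_rpow_mul_exp_neg_mul_rpow hq one_pos hr
    simpa [hw] using this
  have hint : ∫ s in Ioi (0 : ℝ), w s = (1 / r) ^ (q + 1) * Real.Gamma (q + 1) := by
    have := Real.integral_rpow_mul_exp_neg_mul_Ioi (show 0 < q + 1 by linarith) hr
    simpa [hw] using this
  have hwi : IntervalIntegrable w volume 0 x :=
    (intervalIntegrable_iff_integrableOn_Ioc_of_le hx.le).2 (hI.mono_set Ioc_subset_Ioi_self)
  have hwi' : IntervalIntegrable (fun ξ => w (x - ξ)) volume 0 x := by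
    simpa using (hwi.comp_sub_left x).symm
  have hle : ∫ s in (0 : ℝ)..x, w s ≤ (1 / r) ^ (q + 1) * Real.Gamma (q + 1) := by
    rw [← hint, intervalIntegral.integral_of_le hx.le]
    refine setIntegral_mono_set hI ?_ Ioc_subset_Ioi_self.eventuallyLE
    filter_upwards [ae_restrict_mem measurableSet_Ioi] with s hs
    exact mul_nonneg (Real.rpow_nonneg (le_of_lt hs) q) (Real.exp_pos _).le
  have hb : ∀ᵐ ξ ∂volume, ξ ∈ Ioc 0 x → ‖φ (x - ξ) * ψ ξ‖ ≤
      A * M * Real.exp (r * x) * (x / 2) ^ q * (w ξ + w (x - ξ)) := by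
    filter_upwards [Measure.ae_ne volume x] with ξ hne hξ
    have hξ' : ξ ∈ Ioo 0 x := ⟨hξ.1, lt_of_le_of_ne hξ.2 hne⟩
    have h1 := hφ (x - ξ) ⟨by linarith [hξ'.2], by linarith [hξ'.1]⟩
    have h2 := hψ ξ hξ'
    rw [norm_mul]
    calc ‖φ (x - ξ)‖ * ‖ψ ξ‖
        ≤ (A * (Real.exp (r * (x - ξ)) * (x - ξ) ^ q)) * (M * ξ ^ q) := by
          have : 0 ≤ (x - ξ) ^ q := Real.rpow_nonneg (by linarith [hξ'.2]) q
          gcongr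
      _ = A * M * Real.exp (r * x) * ((x - ξ) ^ q * ξ ^ q * Real.exp (-(r * ξ))) := by
          rw [show r * (x - ξ) = r * x + -(r * ξ) by ring, Real.exp_add]; ring
      _ ≤ A * M * Real.exp (r * x) * ((x / 2) ^ q * (w ξ + w (x - ξ))) := by
          exact mul_le_mul_of_nonneg_left (rpow_mul_rpow_mul_exp_le hq0 hr.le hξ') (by positivity)
      _ = _ := by ring
  have hcomp : ∫ ξ in (0 : ℝ)..x, w (x - ξ) = ∫ s in (0 : ℝ)..x, w s := by
    simp
  calc ‖lconv φ ψ x‖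
      ≤ ∫ ξ in (0 : ℝ)..x, A * M * Real.exp (r * x) * (x / 2) ^ q * (w ξ + w (x - ξ)) :=
        intervalIntegral.norm_integral_le_of_norm_le hx.le hb ((hwi.add hwi').const_mul _)
    _ = A * M * Real.exp (r * x) * (x / 2) ^ q * (2 * ∫ s in (0 : ℝ)..x, w s) := by
        rw [intervalIntegral.integral_const_mul, intervalIntegral.integral_add hwi hwi', hcomp]
        ring
    _ ≤ A * M * Real.exp (r * x) * (x / 2) ^ q *
          (2 * ((1 / r) ^ (q + 1) * Real.Gamma (q + 1))) := by
        gcongr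
    _ = _ := by
        rw [div_eq_mul_one_div, Real.mul_rpow hx.le (by norm_num), convRate]
        ring

theorem PowBound.lconv {φ ψ : ℝ → ℂ} {q : ℝ} (hq : -1 < q) (hq0 : q ≤ 0)
    (hφ : PowBound q φ) (hψ : PowBound q ψ) : PowBound q (lconv φ ψ) := by
  intro T
  obtain ⟨A, hA, hbA⟩ := hφ T
  obtain ⟨M, hM, hbM⟩ := hψ T
  have hc := convRate_nonneg hq one_pos
  -- Any rate would serve; with `r = 1` the weight is at most `exp T` on `(0,T]`.
  refine ⟨A * M * convRate q 1 * Real.exp T, by positivity, fun x hx => ?_⟩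
  have hsub : ∀ ξ ∈ Ioo 0 x, ξ ∈ Ioc 0 T := fun ξ hξ => ⟨hξ.1, hξ.2.le.trans hx.2⟩
  refine (norm_lconv_le hq hq0 one_pos hx.1 hA (fun ξ hξ => ?_)
    (fun ξ hξ => hbM ξ (hsub ξ hξ))).trans ?_
  · have h1 : 1 ≤ Real.exp (1 * ξ) := Real.one_le_exp (by linarith [hξ.1])
    have h2 := Real.rpow_nonneg hξ.1.le q
    exact (hbA ξ (hsub ξ hξ)).trans (by gcongr; exact le_mul_of_one_le_left h2 h1)
  · have h2 := Real.rpow_nonneg hx.1.le q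
    rw [← mul_assoc, one_mul]
    gcongr
    exact hx.2

theorem PowBound.locInt {φ : ℝ → ℂ} {q : ℝ} (hq : -1 < q) (hφ : PowBound q φ)
    (hc : ContinuousOn φ (Ioi 0)) : LocInt φ := by
  intro T
  obtain ⟨A, hA, hb⟩ := hφ T
  rcases le_total T 0 with hT | hT
  · simp [Ioc_eq_empty hT.not_gt]
  have hi : IntegrableOn (fun x : ℝ => A * x ^ q) (Ioc 0 T) :=
    (intervalIntegrable_iff_integrableOn_Ioc_of_le hT).1
      ((intervalIntegral.intervalIntegrable_rpow' hq).const_mul A)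
  refine hi.mono' ((hc.mono Ioc_subset_Ioi_self).aestronglyMeasurable measurableSet_Ioc) ?_
  filter_upwards [ae_restrict_mem measurableSet_Ioc] with x hx using hb x hx

/-! ### `C₋₁(0,∞)` as a convolution algebra. -/

theorem MemCNegOne.locInt {φ : ℝ → ℂ} (h : MemCNegOne φ) : LocInt φ := by
  obtain ⟨q, hq, hb⟩ := h.exists_powBound
  exact hb.locInt hq h.continuousOn

theorem MemCNegOne.lconvExistsAt {φ ψ : ℝ → ℂ} (h : MemCNegOne φ) (h' : MemCNegOne ψ)
    {x : ℝ} (hx : 0 < x) : LconvExistsAt φ ψ x := by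
  obtain ⟨q, hq, hq0, hb, hb'⟩ := h.exists_powBound_pair h'
  obtain ⟨A, hA, hbA⟩ := hb x
  obtain ⟨M, hM, hbM⟩ := hb' x
  have hi := (intervalIntegrable_iff_integrableOn_Ioo_of_le hx.le).1
    (intervalIntegrable_rpow_add_rpow hq (A * M * (x / 2) ^ q) x)
  rw [LconvExistsAt, intervalIntegrable_iff_integrableOn_Ioo_of_le hx.le]
  refine hi.mono' (ContinuousOn.aestronglyMeasurable ?_ measurableSet_Ioo) ?_
  · refine ContinuousOn.mul ?_ (h'.continuousOn.mono Ioo_subset_Ioi_self)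
    exact h.continuousOn.comp (by fun_prop) fun ξ hξ => sub_pos.2 hξ.2
  · filter_upwards [ae_restrict_mem measurableSet_Ioo] with ξ hξ
    have h1 := hbA (x - ξ) ⟨by linarith [hξ.2], by linarith [hξ.1]⟩
    have h2 := hbM ξ ⟨hξ.1, hξ.2.le⟩
    have h3 : 0 ≤ (x - ξ) ^ q := Real.rpow_nonneg (by linarith [hξ.2]) q
    rw [norm_mul]
    calc ‖φ (x - ξ)‖ * ‖ψ ξ‖ ≤ (A * (x - ξ) ^ q) * (M * ξ ^ q) := by gcongr
      _ = A * M * ((x - ξ) ^ q * ξ ^ q) := by ring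
      _ ≤ A * M * ((x / 2) ^ q * (ξ ^ q + (x - ξ) ^ q)) := by
          exact mul_le_mul_of_nonneg_left (rpow_mul_rpow_le hq0 hξ) (by positivity)
      _ = _ := by ring

/-- The substitution `ξ = x t` fixes the interval of integration, so continuity in `x` becomes a
matter of dominated convergence. -/
theorem lconv_eq_mul_integral_unit (φ ψ : ℝ → ℂ) {x : ℝ} (hx : x ≠ 0) :
    lconv φ ψ x = x * ∫ t in (0 : ℝ)..1, φ (x * (1 - t)) * ψ (x * t) := by
  have := intervalIntegral.integral_comp_mul_left (a := 0) (b := 1)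
    (fun s => φ (x - s) * ψ s) hx
  simp only [mul_zero, mul_one] at this
  simp_rw [mul_sub, mul_one, this, Complex.real_smul, lconv]
  rw [← mul_assoc, ← Complex.ofReal_mul, mul_inv_cancel₀ hx]
  simp

theorem MemCNegOne.continuousOn_lconv {φ ψ : ℝ → ℂ} (h : MemCNegOne φ) (h' : MemCNegOne ψ) :
    ContinuousOn (lconv φ ψ) (Ioi 0) := by
  obtain ⟨q, hq, hq0, hb, hb'⟩ := h.exists_powBound_pair h'
  intro x₀ hx₀
  have hx₀ : 0 < x₀ := hx₀
  obtain ⟨A, hA, hbA⟩ := hb (2 * x₀)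
  obtain ⟨M, hM, hbM⟩ := hb' (2 * x₀)
  have hnhds : Ioo (x₀ / 2) (2 * x₀) ∈ nhds x₀ := Ioo_mem_nhds (by linarith) (by linarith)
  have key : ContinuousAt (fun x => ∫ t in (0 : ℝ)..1, φ (x * (1 - t)) * ψ (x * t)) x₀ := by
    refine intervalIntegral.continuousAt_of_dominated_interval
      (bound := fun t => (A * M * ((x₀ / 2) ^ q) ^ 2 * (1 / 2) ^ q) * (t ^ q + (1 - t) ^ q))
      ?_ ?_ (intervalIntegrable_rpow_add_rpow hq _ 1) ?_
    · filter_upwards [hnhds] with x hx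
      have hx0 : 0 < x := by linarith [hx.1]
      rw [uIoc_of_le zero_le_one, ← restrict_Ioo_eq_restrict_Ioc]
      refine ContinuousOn.aestronglyMeasurable ?_ measurableSet_Ioo
      refine ContinuousOn.mul ?_ ?_
      · exact h.continuousOn.comp (by fun_prop) fun t ht => mul_pos hx0 (sub_pos.2 ht.2)
      · exact h'.continuousOn.comp (by fun_prop) fun t ht => mul_pos hx0 ht.1
    · filter_upwards [hnhds] with x hx
      have hx0 : 0 < x := by linarith [hx.1]
      filter_upwards [Measure.ae_ne volume (1 : ℝ)] with t hne ht
      rw [uIoc_of_le zero_le_one] at ht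
      have ht1 : 0 < 1 - t := sub_pos.2 (lt_of_le_of_ne ht.2 hne)
      have ht0 := ht.1
      have hxt : ∀ s : ℝ, 0 < s → s ≤ 1 → x * s ∈ Ioc 0 (2 * x₀) := fun s hs hs1 =>
        ⟨by positivity, (mul_le_of_le_one_right hx0.le hs1).trans hx.2.le⟩
      have hp : ∀ s : ℝ, 0 < s → (x * s) ^ q ≤ (x₀ / 2) ^ q * s ^ q := fun s hs => by
        rw [Real.mul_rpow hx0.le hs.le]
        have := Real.rpow_le_rpow_of_nonpos (by linarith) hx.1.le hq0
        have := Real.rpow_nonneg hs.le q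
        gcongr
      have h1 := hbA _ (hxt (1 - t) ht1 (by linarith))
      have h2 := hbM _ (hxt t ht0 ht.2)
      have a0 := Real.rpow_nonneg ht0.le q
      have a1 := Real.rpow_nonneg ht1.le q
      have a2 : 0 ≤ (x₀ / 2) ^ q := by positivity
      rw [norm_mul]
      calc ‖φ (x * (1 - t))‖ * ‖ψ (x * t)‖
          ≤ (A * ((x₀ / 2) ^ q * (1 - t) ^ q)) * (M * ((x₀ / 2) ^ q * t ^ q)) := by
            gcongr
            · exact h1.trans (by gcongr; exact hp _ ht1)
            · exact h2.trans (by gcongr; exact hp _ ht0)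
        _ = A * M * ((x₀ / 2) ^ q) ^ 2 * ((1 - t) ^ q * t ^ q) := by ring
        _ ≤ A * M * ((x₀ / 2) ^ q) ^ 2 * ((1 / 2) ^ q * (t ^ q + (1 - t) ^ q)) := by
            exact mul_le_mul_of_nonneg_left (rpow_mul_rpow_le hq0 ⟨ht0, sub_pos.1 ht1⟩)
              (by positivity)
        _ = _ := by ring
    · filter_upwards [Measure.ae_ne volume (1 : ℝ)] with t hne ht
      rw [uIoc_of_le zero_le_one] at ht
      have ht1 : 0 < 1 - t := sub_pos.2 (lt_of_le_of_ne ht.2 hne)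
      refine ContinuousAt.mul ?_ ?_
      · exact ContinuousAt.comp (f := fun x => x * (1 - t)) (g := φ)
          (h.continuousOn.continuousAt (Ioi_mem_nhds (mul_pos hx₀ ht1))) (by fun_prop)
      · exact ContinuousAt.comp (f := fun x => x * t) (g := ψ)
          (h'.continuousOn.continuousAt (Ioi_mem_nhds (mul_pos hx₀ ht.1))) (by fun_prop)
  have := (Complex.continuous_ofReal.continuousAt (x := x₀)).mul key
  refine (this.congr ?_).continuousWithinAt
  filter_upwards [Ioi_mem_nhds hx₀] with x hx
  exact (lconv_eq_mul_integral_unit φ ψ (ne_of_gt hx)).symm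

theorem MemCNegOne.lconv {φ ψ : ℝ → ℂ} (h : MemCNegOne φ) (h' : MemCNegOne ψ) :
    MemCNegOne (lconv φ ψ) := by
  obtain ⟨q, hq, hq0, hb, hb'⟩ := h.exists_powBound_pair h'
  exact memCNegOne_of_powBound hq (h.continuousOn_lconv h') (hb.lconv hq hq0 hb')

theorem MemCNegOne.const_mul {φ : ℝ → ℂ} (h : MemCNegOne φ) (c : ℂ) :
    MemCNegOne fun x => c * φ x := by
  obtain ⟨p, φ₁, hp, hc, he⟩ := h
  refine ⟨p, fun x => c * φ₁ x, hp, hc.const_mul c, fun x hx => ?_⟩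
  beta_reduce
  rw [he x hx, mul_left_comm]

theorem PowBound.add {φ ψ : ℝ → ℂ} {q : ℝ} (h : PowBound q φ) (h' : PowBound q ψ) :
    PowBound q fun x => φ x + ψ x := by
  intro T
  obtain ⟨A, hA, hbA⟩ := h T
  obtain ⟨M, hM, hbM⟩ := h' T
  refine ⟨A + M, by positivity, fun x hx => (norm_add_le _ _).trans ?_⟩
  rw [add_mul]
  exact add_le_add (hbA x hx) (hbM x hx)

theorem MemCNegOne.add {φ ψ : ℝ → ℂ} (h : MemCNegOne φ) (h' : MemCNegOne ψ) :
    MemCNegOne fun x => φ x + ψ x := by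
  obtain ⟨q, hq, hq0, hb, hb'⟩ := h.exists_powBound_pair h'
  exact memCNegOne_of_powBound hq (h.continuousOn.add h'.continuousOn) (hb.add hb')

theorem memCNegOne_const (c : ℂ) : MemCNegOne fun _ => c :=
  ⟨0, fun _ => c, by norm_num, continuousOn_const, fun x _ => by simp⟩

theorem MemCNegOne.eqOn_of_ae_eq {φ ψ : ℝ → ℂ} (h : MemCNegOne φ) (h' : MemCNegOne ψ)
    (he : φ =ᵐ[volume.restrict (Ioi 0)] ψ) : EqOn φ ψ (Ioi 0) :=
  Measure.eqOn_open_of_ae_eq he isOpen_Ioi h.continuousOn h'.continuousOn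

theorem MemCNegOne.lconv_assoc {φ ψ χ : ℝ → ℂ} (hφ : MemCNegOne φ) (hψ : MemCNegOne ψ)
    (hχ : MemCNegOne χ) :
    EqOn (_root_.lconv (_root_.lconv φ ψ) χ) (_root_.lconv φ (_root_.lconv ψ χ)) (Ioi 0) :=
  ((hφ.lconv hψ).lconv hχ).eqOn_of_ae_eq (hφ.lconv (hψ.lconv hχ))
    (lconv_assoc_ae hφ.locInt hψ.locInt hχ.locInt)

/-! ### Convolution powers and convolution series. -/

theorem MemCNegOne.convPow {f : ℝ → ℂ} (hf : MemCNegOne f) (n : ℕ) :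
    MemCNegOne (convPow f (n + 1)) := by
  induction n with
  | zero => exact hf
  | succ n ih => exact ih.lconv hf

theorem lconv_convPow {f : ℝ → ℂ} (hf : MemCNegOne f) (m n : ℕ) :
    EqOn (lconv (convPow f (m + 1)) (convPow f (n + 1))) (convPow f (m + n + 2)) (Ioi 0) := by
  induction n with
  | zero => exact fun x _ => rfl
  | succ n ih =>
    intro x hx
    have := (hf.convPow m).lconv_assoc (hf.convPow n) hf hx
    change lconv _ (lconv (_root_.convPow f (n + 1)) f) x = _
    rw [← this]
    exact lconv_congr (le_of_lt hx) (ih.mono Ioo_subset_Ioi_self) (eqOn_refl _ _)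

theorem exists_rate_le {q A ε : ℝ} (hq : -1 < q) (hε : 0 < ε) :
    ∃ r : ℝ, 0 < r ∧ A * convRate q r ≤ ε := by
  have h := (tendsto_convRate hq).const_mul A
  rw [mul_zero] at h
  obtain ⟨r, hr, hr0⟩ := ((h.eventually (gt_mem_nhds hε)).and
    (Filter.eventually_gt_atTop 0)).exists
  exact ⟨r, hr0, hr.le⟩

/-- Choose `r` so that each convolution with `f` multiplies the weighted bound by at most `ε`; at
the end `exp (r x)` is absorbed into `exp (r T)`. -/
theorem PowBound.norm_convPow_le {f : ℝ → ℂ} {q : ℝ} (hq : -1 < q) (hq0 : q ≤ 0)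
    (hf : PowBound q f) (T : ℝ) {ε : ℝ} (hε : 0 < ε) :
    ∃ K : ℝ, 0 ≤ K ∧ ∀ n : ℕ, ∀ x ∈ Ioc 0 T, ‖convPow f (n + 1) x‖ ≤ K * ε ^ n * x ^ q := by
  obtain ⟨A, hA, hb⟩ := hf T
  obtain ⟨r, hr, hrate⟩ := exists_rate_le (A := A) hq hε
  have key : ∀ n : ℕ, ∀ x ∈ Ioc 0 T,
      ‖convPow f (n + 1) x‖ ≤ A * ε ^ n * (Real.exp (r * x) * x ^ q) := by
    intro n
    induction n with
    | zero =>
      intro x hx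
      have h1 : 1 ≤ Real.exp (r * x) := Real.one_le_exp (mul_nonneg hr.le hx.1.le)
      have h2 := Real.rpow_nonneg hx.1.le q
      refine (hb x hx).trans ?_
      rw [pow_zero, mul_one]
      gcongr
      exact le_mul_of_one_le_left h2 h1
    | succ n ih =>
      intro x hx
      have h2 := Real.rpow_nonneg hx.1.le q
      have hsub : ∀ ξ ∈ Ioo 0 x, ξ ∈ Ioc 0 T := fun ξ hξ => ⟨hξ.1, hξ.2.le.trans hx.2⟩
      refine (norm_lconv_le hq hq0 hr hx.1 (by positivity) (fun ξ hξ => ih ξ (hsub ξ hξ))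
        (fun ξ hξ => hb ξ (hsub ξ hξ))).trans ?_
      calc A * ε ^ n * A * convRate q r * (Real.exp (r * x) * x ^ q)
          = A * ε ^ n * (A * convRate q r) * (Real.exp (r * x) * x ^ q) := by ring
        _ ≤ A * ε ^ n * ε * (Real.exp (r * x) * x ^ q) := by gcongr
        _ = _ := by ring
  refine ⟨A * Real.exp (r * T), by positivity, fun n x hx => (key n x hx).trans ?_⟩
  have h2 := Real.rpow_nonneg hx.1.le q
  calc A * ε ^ n * (Real.exp (r * x) * x ^ q) ≤ A * ε ^ n * (Real.exp (r * T) * x ^ q) := by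
        gcongr
        exact hx.2
    _ = _ := by ring

/-- A sequence dominated by a geometric one: the coefficients of a power series with non-zero
radius of convergence. -/
def GeomBound (c : ℕ → ℂ) : Prop := ∃ C R : ℝ, 0 ≤ C ∧ 0 < R ∧ ∀ n, ‖c n‖ ≤ C * R ^ n

theorem geomBound_of_radius_pos {c : ℕ → ℂ}
    (h : 0 < (FormalMultilinearSeries.ofScalars ℂ c).radius) : GeomBound c := by
  obtain ⟨r, hr, hr'⟩ := ENNReal.lt_iff_exists_nnreal_btwn.1 h
  have hr0 : 0 < r := by exact_mod_cast hr
  obtain ⟨C, hC, hb⟩ :=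
    FormalMultilinearSeries.norm_le_div_pow_of_pos_of_lt_radius _ hr0 hr'
  refine ⟨C, (r : ℝ)⁻¹, hC.le, by positivity, fun n => ?_⟩
  have := hb n
  rw [FormalMultilinearSeries.ofScalars_norm] at this
  rwa [inv_pow, ← div_eq_mul_inv]

/-- The coefficients of the product of two power series. -/
def cauchyCoeff (a b : ℕ → ℂ) (n : ℕ) : ℂ := ∑ m ∈ Finset.range (n + 1), a m * b (n - m)

theorem GeomBound.cauchyCoeff {a b : ℕ → ℂ} (ha : GeomBound a) (hb : GeomBound b) :
    GeomBound (cauchyCoeff a b) := by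
  obtain ⟨C, R, hC, hR, hCR⟩ := ha
  obtain ⟨D, S, hD, hS, hDS⟩ := hb
  -- The factor `2 ^ n` absorbs the number `n + 1` of summands.
  refine ⟨C * D, 2 * (R + S), by positivity, by positivity, fun n => ?_⟩
  have h2 : ((n + 1 : ℕ) : ℝ) ≤ 2 ^ n := by exact_mod_cast Nat.lt_two_pow_self
  calc ‖∑ m ∈ Finset.range (n + 1), a m * b (n - m)‖
      ≤ ∑ m ∈ Finset.range (n + 1), C * D * (R + S) ^ n := by
        refine norm_sum_le_of_le _ fun m hm => ?_
        have hm' : m ≤ n := by simpa [Nat.lt_succ_iff] using hm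
        rw [norm_mul]
        calc ‖a m‖ * ‖b (n - m)‖ ≤ (C * (R + S) ^ m) * (D * (R + S) ^ (n - m)) := by
              gcongr
              · exact (hCR m).trans (by gcongr; linarith)
              · exact (hDS _).trans (by gcongr; linarith)
          _ = C * D * ((R + S) ^ m * (R + S) ^ (n - m)) := by ring
          _ = _ := by rw [← pow_add, Nat.add_sub_cancel' hm']
    _ = (n + 1 : ℕ) * (C * D * (R + S) ^ n) := by simp
    _ ≤ 2 ^ n * (C * D * (R + S) ^ n) := by gcongr
    _ = _ := by rw [mul_pow]; ring

theorem GeomBound.shift {c : ℕ → ℂ} (hc : GeomBound c) (m : ℕ) : GeomBound fun n => c (m + n) := by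
  obtain ⟨C, R, hC, hR, h⟩ := hc
  refine ⟨C * R ^ m, R, by positivity, hR, fun n => (h _).trans_eq ?_⟩
  rw [pow_add, mul_assoc]

theorem PowBound.norm_convSeries_term_le {f : ℝ → ℂ} {q : ℝ} (hq : -1 < q) (hq0 : q ≤ 0)
    (hf : PowBound q f) {c : ℕ → ℂ} (hc : GeomBound c) (T : ℝ) :
    ∃ K : ℝ, 0 ≤ K ∧ ∀ n : ℕ, ∀ x ∈ Ioc 0 T,
      ‖c (n + 1) * convPow f (n + 1) x‖ ≤ K * (1 / 2) ^ n * x ^ q := by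
  obtain ⟨C, R, hC, hR, h⟩ := hc
  -- This `ε` beats the growth `R ^ n` of the coefficients and leaves ratio `1 / 2`.
  obtain ⟨K, hK, hb⟩ := hf.norm_convPow_le hq hq0 T (ε := 1 / (2 * R)) (by positivity)
  refine ⟨C * R * K, by positivity, fun n x hx => ?_⟩
  have h2 := Real.rpow_nonneg hx.1.le q
  rw [norm_mul]
  calc ‖c (n + 1)‖ * ‖convPow f (n + 1) x‖
      ≤ (C * R ^ (n + 1)) * (K * (1 / (2 * R)) ^ n * x ^ q) := by
        gcongr
        · exact h _
        · exact hb n x hx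
    _ = C * R * K * (R * (1 / (2 * R))) ^ n * x ^ q := by rw [mul_pow, pow_succ]; ring
    _ = _ := by rw [show R * (1 / (2 * R)) = 1 / 2 by field_simp]

theorem MemCNegOne.exists_powBound_nonpos {φ : ℝ → ℂ} (h : MemCNegOne φ) :
    ∃ q : ℝ, -1 < q ∧ q ≤ 0 ∧ PowBound q φ := by
  obtain ⟨q, hq, hq0, hb, -⟩ := h.exists_powBound_pair h
  exact ⟨q, hq, hq0, hb⟩

theorem MemCNegOne.summable_norm_convSeries {f : ℝ → ℂ} (hf : MemCNegOne f) {c : ℕ → ℂ}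
    (hc : GeomBound c) {x : ℝ} (hx : 0 < x) :
    Summable fun n : ℕ => ‖c (n + 1) * _root_.convPow f (n + 1) x‖ := by
  obtain ⟨q, hq, hq0, hb⟩ := hf.exists_powBound_nonpos
  obtain ⟨K, hK, hbd⟩ := hb.norm_convSeries_term_le hq hq0 hc x
  exact .of_nonneg_of_le (fun _ => norm_nonneg _) (fun n => hbd n x ⟨hx, le_rfl⟩)
    ((summable_geometric_two.mul_left K).mul_right _)

theorem MemCNegOne.convSeries {f : ℝ → ℂ} (hf : MemCNegOne f) {c : ℕ → ℂ}
    (hc : GeomBound c) : MemCNegOne (convSeries c f) := by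
  obtain ⟨q, hq, hq0, hb⟩ := hf.exists_powBound_nonpos
  refine memCNegOne_of_powBound hq ?_ fun T => ?_
  · intro x₀ hx₀
    have hx₀ : 0 < x₀ := hx₀
    obtain ⟨K, hK, hbd⟩ := hb.norm_convSeries_term_le hq hq0 hc (2 * x₀)
    have : ContinuousOn (_root_.convSeries c f) (Ioo (x₀ / 2) (2 * x₀)) := by
      refine continuousOn_tsum (u := fun n => K * (1 / 2) ^ n * (x₀ / 2) ^ q) (fun n => ?_)
        ((summable_geometric_two.mul_left K).mul_right _) fun n x hx => ?_
      · refine ContinuousOn.mono ?_ (fun x hx => (by linarith [hx.1] : 0 < x))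
        exact (hf.convPow n).continuousOn.const_mul _
      · refine (hbd n x ⟨by linarith [hx.1], hx.2.le⟩).trans ?_
        have := Real.rpow_le_rpow_of_nonpos (by linarith) hx.1.le hq0
        gcongr
    exact (this.continuousAt (Ioo_mem_nhds (by linarith) (by linarith))).continuousWithinAt
  · obtain ⟨K, hK, hbd⟩ := hb.norm_convSeries_term_le hq hq0 hc T
    refine ⟨K * 2, by positivity, fun x hx => ?_⟩
    exact tsum_of_norm_bounded ((hasSum_geometric_two.mul_left K).mul_right _)
      fun n => hbd n x hx

/-! ### Products of convolution series. -/

/-- Sum and integral are exchanged over `ℕ × ℕ`: the integrals of the norms are dominated by a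
product of two geometric series times the integral of one integrable function. -/
theorem MemCNegOne.hasSum_lconv_convSeries {f : ℝ → ℂ} (hf : MemCNegOne f) {a b : ℕ → ℂ}
    (ha : GeomBound a) (hb : GeomBound b) {x : ℝ} (hx : 0 < x) :
    HasSum (fun i : ℕ × ℕ => a (i.1 + 1) * b (i.2 + 1) * _root_.convPow f (i.1 + i.2 + 2) x)
      (_root_.lconv (_root_.convSeries a f) (_root_.convSeries b f) x) := by
  obtain ⟨q, hq, hq0, hfb⟩ := hf.exists_powBound_nonpos
  obtain ⟨K, hK, hbK⟩ := hfb.norm_convSeries_term_le hq hq0 ha x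
  obtain ⟨L, hL, hbL⟩ := hfb.norm_convSeries_term_le hq hq0 hb x
  set F : ℕ × ℕ → ℝ → ℂ := fun i ξ =>
    (a (i.1 + 1) * _root_.convPow f (i.1 + 1) (x - ξ)) *
      (b (i.2 + 1) * _root_.convPow f (i.2 + 1) ξ) with hF
  have hFi : ∀ i, Integrable (F i) (volume.restrict (Ioo 0 x)) := fun i =>
    (intervalIntegrable_iff_integrableOn_Ioo_of_le hx.le).1
      (((hf.convPow i.1).const_mul (a (i.1 + 1))).lconvExistsAt
        ((hf.convPow i.2).const_mul (b (i.2 + 1))) hx)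
  set w : ℝ → ℝ := fun ξ => (x / 2) ^ q * (ξ ^ q + (x - ξ) ^ q) with hw
  have hwi : IntegrableOn w (Ioo 0 x) :=
    (intervalIntegrable_iff_integrableOn_Ioo_of_le hx.le).1 (intervalIntegrable_rpow_add_rpow hq _ x)
  have hFn : ∀ i, ∫ ξ in Ioo 0 x, ‖F i ξ‖ ≤
      K * (1 / 2) ^ i.1 * (L * (1 / 2) ^ i.2) * ∫ ξ in Ioo 0 x, w ξ := by
    intro i
    rw [← integral_const_mul]
    refine setIntegral_mono_on (hFi i).norm (hwi.const_mul _) measurableSet_Ioo fun ξ hξ => ?_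
    have h1 := hbK i.1 (x - ξ) ⟨by linarith [hξ.2], by linarith [hξ.1]⟩
    have h2 := hbL i.2 ξ ⟨hξ.1, hξ.2.le⟩
    have h3 : 0 ≤ (x - ξ) ^ q := Real.rpow_nonneg (by linarith [hξ.2]) q
    rw [hF, norm_mul]
    refine (mul_le_mul h1 h2 (norm_nonneg _) (by positivity)).trans ?_
    calc K * (1 / 2) ^ i.1 * (x - ξ) ^ q * (L * (1 / 2) ^ i.2 * ξ ^ q)
        = K * (1 / 2) ^ i.1 * (L * (1 / 2) ^ i.2) * ((x - ξ) ^ q * ξ ^ q) := by ring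
      _ ≤ _ := mul_le_mul_of_nonneg_left (rpow_mul_rpow_le hq0 hξ) (by positivity)
  have hsum : Summable fun i : ℕ × ℕ =>
      K * (1 / 2 : ℝ) ^ i.1 * (L * (1 / 2) ^ i.2) * ∫ ξ in Ioo 0 x, w ξ :=
    Summable.mul_right _ ((summable_geometric_two.mul_left K).mul_of_nonneg
      (summable_geometric_two.mul_left L) (fun n => by positivity) (fun n => by positivity))
  have hs := hasSum_integral_of_summable_integral_norm hFi
    (.of_nonneg_of_le (fun i => by positivity) hFn hsum)
  have hlhs : ∀ i : ℕ × ℕ, ∫ ξ in Ioo 0 x, F i ξ =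
      a (i.1 + 1) * b (i.2 + 1) * _root_.convPow f (i.1 + i.2 + 2) x := fun i => by
    rw [← integral_Ioc_eq_integral_Ioo, ← intervalIntegral.integral_of_le hx.le]
    change _root_.lconv (fun t => a (i.1 + 1) * _root_.convPow f (i.1 + 1) t)
      (fun t => b (i.2 + 1) * _root_.convPow f (i.2 + 1) t) x = _
    rw [lconv_const_mul_left, lconv_const_mul_right, lconv_convPow hf _ _ hx, mul_assoc]
  have hrhs : ∫ ξ in Ioo 0 x, ∑' i, F i ξ =
      _root_.lconv (_root_.convSeries a f) (_root_.convSeries b f) x := by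
    rw [_root_.lconv, intervalIntegral.integral_of_le hx.le, integral_Ioc_eq_integral_Ioo]
    refine setIntegral_congr_fun measurableSet_Ioo fun ξ hξ => ?_
    exact (tsum_mul_tsum_of_summable_norm (hf.summable_norm_convSeries ha (sub_pos.2 hξ.2))
      (hf.summable_norm_convSeries hb hξ.1)).symm
  rw [hrhs] at hs
  simpa only [hlhs] using hs

/-- The two end terms carry `a 0` and `b 0`, the coefficients of the formal unit, which lie outside
the convolution series; the rest comes from the product of the series. -/
theorem cauchyCoeff_succ_succ (a b : ℕ → ℂ) (n : ℕ) :
    cauchyCoeff a b (n + 2) = a 0 * b (n + 2) + b 0 * a (n + 2) +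
      ∑ i ∈ Finset.HasAntidiagonal.antidiagonal n, a (i.1 + 1) * b (i.2 + 1) := by
  rw [cauchyCoeff, Finset.sum_range_succ, Finset.sum_range_succ',
    Finset.Nat.sum_antidiagonal_eq_sum_range_succ fun i j => a (i + 1) * b (j + 1)]
  have : ∀ k ∈ Finset.range (n + 1), a (k + 1) * b (n + 2 - (k + 1)) =
      a (k + 1) * b (n - k + 1) := fun k hk => by
    rw [show n + 2 - (k + 1) = n - k + 1 by have := Finset.mem_range.1 hk; omega]
  rw [Finset.sum_congr rfl this]
  simp only [tsub_zero, tsub_self]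
  ring

/-- The convolution product of two convolution series. -/
theorem MemCNegOne.convSeries_cauchyCoeff {f : ℝ → ℂ} (hf : MemCNegOne f) {a b : ℕ → ℂ}
    (ha : GeomBound a) (hb : GeomBound b) {x : ℝ} (hx : 0 < x) :
    _root_.convSeries (_root_.cauchyCoeff a b) f x =
      a 0 * _root_.convSeries b f x + b 0 * _root_.convSeries a f x +
        _root_.lconv (_root_.convSeries b f) (_root_.convSeries a f) x := by
  have h0 := (Finset.HasAntidiagonal.sigmaAntidiagonalEquivProd.hasSum_iff.2
    (hf.hasSum_lconv_convSeries ha hb hx)).sigma fun n => hasSum_fintype _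
  have h1 : HasSum (fun n => (∑ i ∈ Finset.HasAntidiagonal.antidiagonal n, a (i.1 + 1) * b (i.2 + 1)) *
      _root_.convPow f (n + 2) x)
      (_root_.lconv (_root_.convSeries a f) (_root_.convSeries b f) x) := by
    refine h0.congr_fun fun n => ?_
    rw [Finset.sum_mul, ← Finset.sum_coe_sort]
    refine Finset.sum_congr rfl fun i _ => ?_
    have hi := Finset.HasAntidiagonal.mem_antidiagonal.1 i.2
    change _ = a ((i : ℕ × ℕ).1 + 1) * b ((i : ℕ × ℕ).2 + 1) *
      _root_.convPow f ((i : ℕ × ℕ).1 + (i : ℕ × ℕ).2 + 2) x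
    rw [hi]
  have hA := (hf.summable_norm_convSeries ha hx).of_norm.hasSum
  have hB := (hf.summable_norm_convSeries hb hx).of_norm.hasSum
  -- The product of the series starts at `f^{<2>}`, so the `f^{<1>}` terms are removed here and
  -- restored in `hE`.
  have hA' := (hasSum_nat_add_iff' 1).2 hA
  have hB' := (hasSum_nat_add_iff' 1).2 hB
  have hC := ((hB'.mul_left (a 0)).add (hA'.mul_left (b 0))).add h1
  have hD : HasSum (fun n => _root_.cauchyCoeff a b (n + 1 + 1) *
      _root_.convPow f (n + 1 + 1) x) _ := hC.congr_fun fun n => by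
    rw [cauchyCoeff_succ_succ]; ring
  have hE := (hasSum_nat_add_iff (f := fun n => _root_.cauchyCoeff a b (n + 1) *
      _root_.convPow f (n + 1) x) 1).1 hD
  rw [_root_.convSeries, hE.tsum_eq, lconv_comm (_root_.convSeries b f)]
  simp only [zero_add, _root_.convSeries, _root_.cauchyCoeff,
    Finset.sum_range_succ, Finset.sum_range_zero, tsub_zero, tsub_self]
  ring

/-! ### Titchmarsh's theorem for squares. -/

/-- Makes the truncated transform entire, so that Liouville's theorem applies. -/
theorem hasDerivAt_integral_exp_mul {T : ℝ} {g : ℝ → ℂ} (hg : IntegrableOn g (Ioc 0 T))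
    (z : ℂ) :
    HasDerivAt (fun z : ℂ => ∫ t in Ioc 0 T, Complex.exp (z * (T - t : ℝ)) * g t)
      (∫ t in Ioc 0 T, (T - t : ℝ) * Complex.exp (z * (T - t : ℝ)) * g t) z := by
  have hmeas : ∀ h : ℝ → ℂ, Continuous h →
      AEStronglyMeasurable (fun t => h t * g t) (volume.restrict (Ioc 0 T)) := fun h hh =>
    hh.aestronglyMeasurable.mul hg.aestronglyMeasurable
  have hexp : ∀ (w : ℂ) (t : ℝ), t ∈ Ioc 0 T →
      ‖Complex.exp (w * (T - t : ℝ))‖ ≤ Real.exp (‖w‖ * T) := fun w t ht => by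
    rw [Complex.norm_exp, Complex.re_mul_ofReal]
    refine Real.exp_le_exp.2 ?_
    have h1 := Complex.re_le_norm w
    have h2 : 0 ≤ T - t := sub_nonneg.2 ht.2
    calc w.re * (T - t) ≤ ‖w‖ * (T - t) := by gcongr
      _ ≤ ‖w‖ * T := by gcongr; linarith [ht.1]
  refine (hasDerivAt_integral_of_dominated_loc_of_deriv_le
    (F := fun (z : ℂ) (t : ℝ) => Complex.exp (z * (T - t : ℝ)) * g t)
    (F' := fun (z : ℂ) (t : ℝ) => (T - t : ℝ) * Complex.exp (z * (T - t : ℝ)) * g t)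
    (bound := fun t => T * Real.exp ((‖z‖ + 1) * T) * ‖g t‖)
    (Metric.ball_mem_nhds z one_pos) ?_ ?_ ?_ ?_ ?_ ?_).2
  · exact .of_forall fun w => hmeas _ (by fun_prop)
  · refine (hg.norm.const_mul (Real.exp (‖z‖ * T))).mono' (hmeas _ (by fun_prop)) ?_
    filter_upwards [ae_restrict_mem measurableSet_Ioc] with t ht
    rw [norm_mul]
    exact mul_le_mul_of_nonneg_right (hexp z t ht) (norm_nonneg _)
  · exact hmeas _ (by fun_prop)
  · filter_upwards [ae_restrict_mem measurableSet_Ioc] with t ht w hw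
    have hw' : ‖w‖ ≤ ‖z‖ + 1 := by
      have := norm_le_norm_add_norm_sub' w z
      rw [Metric.mem_ball, dist_eq_norm] at hw
      linarith
    have h2 : 0 ≤ T - t := sub_nonneg.2 ht.2
    have hT : 0 ≤ T := ht.1.le.trans ht.2
    rw [norm_mul, norm_mul, Complex.norm_real, Real.norm_of_nonneg h2]
    gcongr
    · linarith [ht.1]
    · exact (hexp w t ht).trans (by gcongr)
  · exact hg.norm.const_mul _
  · refine .of_forall fun t w _ => ?_
    have := (((hasDerivAt_id w).mul_const ((T - t : ℝ) : ℂ)).cexp).mul_const (g t)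
    simpa [mul_comm, mul_left_comm, mul_assoc] using this

/-- If `g * g = 0` on `(0,2T)`, then `∫₀ᵀ exp (z (T - t)) g(t) dt` is bounded on the right
half-plane. -/
theorem exists_bound_of_lconv_self_eq_zero {g : ℝ → ℂ} (hg : LocInt g)
    (h0 : ∀ x : ℝ, 0 < x → lconv g g x = 0) {T : ℝ} (hT : 0 ≤ T) :
    ∃ C : ℝ, ∀ z : ℂ, 0 ≤ z.re →
      ‖∫ t in Ioc 0 T, Complex.exp (z * (T - t : ℝ)) * g t‖ ≤ C := by
  -- Truncating at `2 * T` rather than `T` keeps `u * u` equal to `g * g`, hence zero, up to `2 *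
  -- T`.
  set u := trunc (2 * T) g with hu
  have hui : Integrable u := hg.integrable_trunc _
  set h := u ⋆[ContinuousLinearMap.mul ℂ ℂ] u with hh
  have hhi : Integrable h := hui.integrable_convolution _ hui
  have hh0 : ∀ s ≤ 2 * T, h s = 0 := fun s hs => by
    rcases le_or_gt s 0 with hs0 | hs0
    · exact convolution_of_nonpos hs0 (fun _ => trunc_of_nonpos) (fun _ => trunc_of_nonpos)
    · rw [hh, convolution_trunc_eqOn g g (2 * T) ⟨hs0, hs⟩, h0 s hs0]
  refine ⟨Real.sqrt (∫ s, ‖h s‖) + ∫ t, ‖u t‖, fun z hz => ?_⟩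
  set e : ℝ → ℂ := fun t => Complex.exp (z * (T - t : ℝ)) with he
  have hec : Continuous e := by fun_prop
  have hnorm : ∀ t, ‖e t‖ = Real.exp (z.re * (T - t)) := fun t => by
    rw [he, Complex.norm_exp, Complex.re_mul_ofReal]
  set v : ℝ → ℂ := fun t => e t * u t with hv
  have hvb : ∀ t, ‖v t‖ ≤ Real.exp (z.re * T) * ‖u t‖ := fun t => by
    rcases le_or_gt t 0 with ht | ht
    · simp [hv, hu, trunc_of_nonpos ht]
    · rw [hv, norm_mul, hnorm]
      gcongr
      linarith
  have hvi : Integrable v := (hui.norm.const_mul _).mono'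
    (hec.aestronglyMeasurable.mul hui.aestronglyMeasurable) (.of_forall hvb)
  have hconv : ∀ s, (v ⋆[ContinuousLinearMap.mul ℂ ℂ] v) s =
      Complex.exp (z * (2 * T - s : ℝ)) * h s := fun s => by
    rw [hh, convolution, convolution, ← integral_const_mul]
    congr 1 with t
    simp only [hv, he, ContinuousLinearMap.mul_apply']
    rw [show z * (2 * T - s : ℝ) = z * (T - t : ℝ) + z * (T - (s - t) : ℝ) by push_cast; ring,
      Complex.exp_add]
    ring
  -- Exponential twisting commutes with convolution, so the square of the integral is a twisted
  -- integral of `h`. Only `s > 2 * T` contributes, and there the exponential has norm at most `1`.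
  have hsq : (∫ t, v t) * (∫ t, v t) = ∫ s, Complex.exp (z * (2 * T - s : ℝ)) * h s := by
    have := integral_convolution (ContinuousLinearMap.mul ℂ ℂ) hvi hvi
    rw [ContinuousLinearMap.mul_apply'] at this
    rw [← this]
    simp_rw [hconv]
  have hsqn : ‖∫ t, v t‖ ^ 2 ≤ ∫ s, ‖h s‖ := by
    rw [sq, ← norm_mul, hsq]
    refine norm_integral_le_of_norm_le hhi.norm (.of_forall fun s => ?_)
    rcases le_or_gt s (2 * T) with hs | hs
    · simp [hh0 s hs]
    · rw [norm_mul, Complex.norm_exp, Complex.re_mul_ofReal]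
      refine mul_le_of_le_one_left (norm_nonneg _) (Real.exp_le_one_iff.2 ?_)
      exact mul_nonpos_of_nonneg_of_nonpos hz (by linarith)
  have hsplit : ∫ t, v t = (∫ t in Ioc 0 T, e t * g t) + ∫ t in Ioi T, v t := by
    have h1 : ∫ t, v t = ∫ t in Ioi 0, v t := by
      rw [← integral_indicator measurableSet_Ioi]
      congr 1 with t
      rcases le_or_gt t 0 with ht | ht
      · rw [indicator_of_notMem (by simpa using ht), hv, hu]
        simp [trunc_of_nonpos ht]
      · rw [indicator_of_mem (mem_Ioi.2 ht)]
    rw [h1, ← Ioc_union_Ioi_eq_Ioi hT, setIntegral_union Ioc_disjoint_Ioi_same measurableSet_Ioi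
      hvi.integrableOn hvi.integrableOn]
    congr 1
    refine setIntegral_congr_fun measurableSet_Ioc fun t ht => ?_
    simp only [hv, hu, trunc]
    rw [indicator_of_mem (show t ∈ Ioc 0 (2 * T) from ⟨ht.1, by linarith [ht.2]⟩)]
  have htail : ‖∫ t in Ioi T, v t‖ ≤ ∫ t, ‖u t‖ := by
    refine (norm_integral_le_of_norm_le hui.norm.integrableOn ?_).trans
      (setIntegral_le_integral hui.norm (.of_forall fun t => norm_nonneg _))
    filter_upwards [ae_restrict_mem measurableSet_Ioi] with t ht
    rw [hv, norm_mul, hnorm]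
    refine mul_le_of_le_one_left (norm_nonneg _) (Real.exp_le_one_iff.2 ?_)
    exact mul_nonpos_of_nonneg_of_nonpos hz (by linarith [mem_Ioi.1 ht])
  have hmain : ∫ t in Ioc 0 T, e t * g t = (∫ t, v t) - ∫ t in Ioi T, v t := by
    rw [hsplit]; ring
  change ‖∫ t in Ioc 0 T, e t * g t‖ ≤ _
  rw [hmain]
  exact (norm_sub_le _ _).trans (add_le_add (Real.le_sqrt_of_sq_le hsqn) htail)

/-- The integral is entire in `z`, bounded for `Re z ≥ 0` by the previous lemma and for `Re z ≤ 0`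
because `T - t ≥ 0`. By Liouville it is constant, and along `z = -n` it tends to `0`. -/
theorem integral_exp_mul_eq_zero_of_lconv_self {g : ℝ → ℂ} (hg : LocInt g)
    (h0 : ∀ x : ℝ, 0 < x → lconv g g x = 0) {T : ℝ} (hT : 0 ≤ T) (z : ℂ) :
    ∫ t in Ioc 0 T, Complex.exp (z * (T - t : ℝ)) * g t = 0 := by
  set G : ℂ → ℂ := fun z => ∫ t in Ioc 0 T, Complex.exp (z * (T - t : ℝ)) * g t with hG
  obtain ⟨C, hC⟩ := exists_bound_of_lconv_self_eq_zero hg h0 hT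
  have hleft : ∀ w : ℂ, w.re ≤ 0 → ∀ᵐ t ∂(volume.restrict (Ioc 0 T)),
      ‖Complex.exp (w * (T - t : ℝ)) * g t‖ ≤ ‖g t‖ := fun w hw => by
    filter_upwards [ae_restrict_mem measurableSet_Ioc] with t ht
    rw [norm_mul, Complex.norm_exp, Complex.re_mul_ofReal]
    refine mul_le_of_le_one_left (norm_nonneg _) (Real.exp_le_one_iff.2 ?_)
    exact mul_nonpos_of_nonpos_of_nonneg hw (sub_nonneg.2 ht.2)
  have hd : Differentiable ℂ G := fun w =>
    (hasDerivAt_integral_exp_mul (hg T) w).differentiableAt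
  have hbdd : Bornology.IsBounded (range G) := by
    refine isBounded_iff_forall_norm_le.2 ⟨max C (∫ t in Ioc 0 T, ‖g t‖), ?_⟩
    rintro _ ⟨w, rfl⟩
    rcases le_total 0 w.re with hw | hw
    · exact (hC w hw).trans (le_max_left _ _)
    · exact (norm_integral_le_of_norm_le (hg T).norm (hleft w hw)).trans (le_max_right _ _)
  have hlim : Filter.Tendsto (fun n : ℕ => G (-(n : ℂ))) Filter.atTop (nhds 0) := by
    have : (0 : ℂ) = ∫ t in Ioc 0 T, (0 : ℂ) := by simp
    rw [this]
    refine tendsto_integral_of_dominated_convergence (fun t => ‖g t‖) (fun n => ?_) (hg T).norm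
      (fun n => hleft _ (by simp)) ?_
    · exact (Continuous.aestronglyMeasurable (by fun_prop)).mul (hg T).aestronglyMeasurable
    · filter_upwards [ae_restrict_mem measurableSet_Ioc,
        ae_restrict_of_ae (Measure.ae_ne volume T)] with t ht hne
      have hpos : 0 < T - t := sub_pos.2 (lt_of_le_of_ne ht.2 hne)
      rw [← zero_mul (g t)]
      refine Filter.Tendsto.mul_const _ ?_
      rw [tendsto_zero_iff_norm_tendsto_zero]
      simp_rw [Complex.norm_exp, Complex.re_mul_ofReal, Complex.neg_re, Complex.natCast_re]
      refine Real.tendsto_exp_atBot.comp ?_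
      simp_rw [neg_mul]
      exact Filter.tendsto_neg_atTop_atBot.comp
        (tendsto_natCast_atTop_atTop.atTop_mul_const hpos)
  have hconst : ∀ n : ℕ, G (-(n : ℂ)) = G z := fun n => hd.apply_eq_apply_of_bounded hbdd _ _
  simp_rw [hconst] at hlim
  exact tendsto_nhds_unique tendsto_const_nhds hlim

/-- The special case `g * g = 0` of Titchmarsh's convolution theorem. -/
theorem MemCNegOne.eq_zero_of_lconv_self {g : ℝ → ℂ} (hg : MemCNegOne g)
    (h0 : ∀ x : ℝ, 0 < x → _root_.lconv g g x = 0) : ∀ x : ℝ, 0 < x → g x = 0 := by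
  intro x hx
  -- Any `T > x` would do: `x` must be interior for the truncation to be continuous there.
  set T := 2 * x with hT
  have hT0 : 0 ≤ T := by positivity
  set w := trunc T g with hw
  have hwi : Integrable w := hg.locInt.integrable_trunc T
  -- On the imaginary axis the vanishing integral is, up to a unimodular factor, the Fourier
  -- transform of the truncation.
  have hF : 𝓕 w = 0 := by
    ext y
    rw [Real.fourier_real_eq_integral_exp_smul, Pi.zero_apply]
    have h1 := integral_exp_mul_eq_zero_of_lconv_self hg.locInt h0 hT0
      (2 * Real.pi * y * Complex.I)
    have h2 : ∀ t : ℝ, Complex.exp ((-2 * Real.pi * t * y : ℝ) * Complex.I) • w t =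
        indicator (Ioc 0 T) (fun t : ℝ => Complex.exp (-(2 * Real.pi * y * Complex.I * T)) *
          (Complex.exp (2 * Real.pi * y * Complex.I * (T - t : ℝ)) * g t)) t := fun t => by
      by_cases ht : t ∈ Ioc 0 T
      · rw [hw, trunc, indicator_of_mem ht, indicator_of_mem ht, smul_eq_mul, ← mul_assoc,
          ← Complex.exp_add]
        congr 2
        push_cast
        ring
      · rw [hw, trunc, indicator_of_notMem ht, indicator_of_notMem ht, smul_zero]
    simp_rw [h2]
    rw [integral_indicator measurableSet_Ioc, integral_const_mul, h1, mul_zero]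
  have hc : ContinuousAt w x := by
    refine (hg.continuousOn.continuousAt (Ioi_mem_nhds hx)).congr ?_
    filter_upwards [Ioo_mem_nhds hx (show x < T by linarith)] with t ht
    exact (trunc_eqOn le_rfl ht).symm
  have hinv := hwi.fourierInv_fourier_eq (by rw [hF]; exact integrable_zero _ _ _) hc
  rw [hF, Real.fourierInv_eq] at hinv
  simp only [Pi.zero_apply, smul_zero, integral_zero] at hinv
  rw [hw, trunc_eqOn le_rfl ⟨hx, by linarith⟩] at hinv
  exact hinv.symm

/-! ### Multiplicativity of the action of power series on kernels. -/

theorem LocInt.convSeriesKernel {κ f : ℝ → ℂ} {c : ℕ → ℂ} (hκ : LocInt κ)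
    (hC : LocInt (convSeries c f)) : LocInt (convSeriesKernel κ c f) :=
  (hκ.const_mul (c 0)).add (hκ.lconv hC)

theorem MemCNegOne.convSeriesKernel {κ f : ℝ → ℂ} {c : ℕ → ℂ} (hκ : MemCNegOne κ)
    (hf : MemCNegOne f) (hc : GeomBound c) : MemCNegOne (convSeriesKernel κ c f) :=
  (hκ.const_mul (c 0)).add (hκ.lconv (hf.convSeries hc))

theorem convSeriesKernel_congr_ae {κ κ' f : ℝ → ℂ} (c : ℕ → ℂ)
    (h : κ =ᵐ[volume.restrict (Ioi 0)] κ') :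
    convSeriesKernel κ c f =ᵐ[volume.restrict (Ioi 0)] convSeriesKernel κ' c f := by
  filter_upwards [h, ae_restrict_mem measurableSet_Ioi] with x hx hx0
  rw [convSeriesKernel, convSeriesKernel, hx,
    lconv_congr_ae h (Filter.EventuallyEq.refl _ _) (le_of_lt hx0)]

/-- Associativity and commutativity give `(κ * A) * k = (κ * k) * A`, so the series can be pulled
out of the left factor; by commutativity the same serves the right factor. -/
theorem lconv_convSeriesKernel_left {κ k f : ℝ → ℂ} {a : ℕ → ℂ} (hκ : LocInt κ) (hk : LocInt k)
    (hA : LocInt (convSeries a f)) :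
    lconv (convSeriesKernel κ a f) k =ᵐ[volume.restrict (Ioi 0)]
      convSeriesKernel (lconv κ k) a f := by
  filter_upwards [(hκ.const_mul (a 0)).ae_lconvExistsAt hk, (hκ.lconv hA).ae_lconvExistsAt hk,
    lconv_assoc_ae hκ hA hk, lconv_assoc_ae hκ hk hA] with x h1 h2 h3 h4
  have hcomm : lconv (convSeries a f) k = lconv k (convSeries a f) :=
    funext (lconv_comm _ _)
  rw [hcomm, ← h4] at h3
  change lconv (fun t => a 0 * κ t + lconv κ (convSeries a f) t) k x = _
  rw [h1.lconv_add_left h2, lconv_const_mul_left, h3, convSeriesKernel]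

theorem convSeriesKernel_convSeriesKernel {κ f : ℝ → ℂ} {a b : ℕ → ℂ} (hκ : LocInt κ)
    (hf : MemCNegOne f) (ha : GeomBound a) (hb : GeomBound b) :
    convSeriesKernel (convSeriesKernel κ b f) a f =ᵐ[volume.restrict (Ioi 0)]
      convSeriesKernel κ (cauchyCoeff a b) f := by
  have hA := (hf.convSeries ha).locInt
  have hB := (hf.convSeries hb).locInt
  filter_upwards [(hκ.const_mul (b 0)).ae_lconvExistsAt hA, (hκ.lconv hB).ae_lconvExistsAt hA,
    lconv_assoc_ae hκ hB hA, hκ.ae_lconvExistsAt (hB.const_mul (a 0)),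
    hκ.ae_lconvExistsAt (hA.const_mul (b 0)),
    hκ.ae_lconvExistsAt ((hB.const_mul (a 0)).add (hA.const_mul (b 0))),
    hκ.ae_lconvExistsAt (hB.lconv hA), ae_restrict_mem measurableSet_Ioi]
    with x h1 h2 h3 h4 h5 h6 h7 hx
  have hL : lconv (convSeriesKernel κ b f) (convSeries a f) x =
      b 0 * lconv κ (convSeries a f) x + lconv κ (lconv (convSeries b f) (convSeries a f)) x := by
    change lconv (fun t => b 0 * κ t + lconv κ (convSeries b f) t) _ x = _
    rw [h1.lconv_add_left h2, lconv_const_mul_left, h3]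
  have hR : lconv κ (convSeries (cauchyCoeff a b) f) x =
      a 0 * lconv κ (convSeries b f) x + b 0 * lconv κ (convSeries a f) x +
        lconv κ (lconv (convSeries b f) (convSeries a f)) x := by
    rw [lconv_congr (le_of_lt hx) (eqOn_refl κ _)
      (fun t ht => hf.convSeries_cauchyCoeff ha hb ht.1), h6.lconv_add_right h7,
      h4.lconv_add_right h5, lconv_const_mul_right, lconv_const_mul_right]
  rw [convSeriesKernel, hL, convSeriesKernel, convSeriesKernel, hR]
  simp only [cauchyCoeff, zero_add, Finset.sum_range_one, tsub_zero]
  ring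

theorem lconv_convSeriesKernel {κ k f : ℝ → ℂ} {a b : ℕ → ℂ} (hκ : LocInt κ) (hk : LocInt k)
    (hf : MemCNegOne f) (ha : GeomBound a) (hb : GeomBound b) :
    lconv (convSeriesKernel κ a f) (convSeriesKernel k b f) =ᵐ[volume.restrict (Ioi 0)]
      convSeriesKernel (lconv κ k) (cauchyCoeff a b) f := by
  have hA := (hf.convSeries ha).locInt
  have hB := (hf.convSeries hb).locInt
  refine (lconv_convSeriesKernel_left hκ (hk.convSeriesKernel hB) hA).trans ?_
  refine .trans (convSeriesKernel_congr_ae a ?_)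
    (convSeriesKernel_convSeriesKernel (hκ.lconv hk) hf ha hb)
  rw [show lconv κ (convSeriesKernel k b f) = lconv (convSeriesKernel k b f) κ from
      funext (lconv_comm _ _), show lconv κ k = lconv k κ from funext (lconv_comm _ _)]
  exact lconv_convSeriesKernel_left hk hκ hB

/-! ### Uniqueness of the coefficients. -/

/-- Differentiating the constant function `∫₀ˣ C` gives `C = 0`; its value at `x = 1` then gives `c
= d`. -/
theorem MemCNegOne.eq_zero_of_add_integral_const {C : ℝ → ℂ} (hC : MemCNegOne C) {c d : ℂ}
    (h : ∀ x : ℝ, 0 < x → c + _root_.lconv (fun _ => 1) C x = d) :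
    c = d ∧ ∀ x : ℝ, 0 < x → C x = 0 := by
  have hF : ∀ x : ℝ, 0 < x → ∫ ξ in (0 : ℝ)..x, C ξ = d - c := fun x hx => by
    rw [← h x hx, _root_.lconv]
    simp
  have h0 : ∀ x : ℝ, 0 < x → C x = 0 := fun x hx => by
    have hcx := hC.continuousOn.continuousAt (Ioi_mem_nhds hx)
    have h1 : HasDerivAt (fun y => ∫ ξ in (0 : ℝ)..y, C ξ) (C x) x :=
      intervalIntegral.integral_hasDerivAt_right
        ((intervalIntegrable_iff_integrableOn_Ioc_of_le hx.le).2 (hC.locInt x))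
        (hC.continuousOn.stronglyMeasurableAtFilter isOpen_Ioi x hx) hcx
    have h2 : HasDerivAt (fun y => ∫ ξ in (0 : ℝ)..y, C ξ) 0 x := by
      refine (hasDerivAt_const x (d - c)).congr_of_eventuallyEq ?_
      filter_upwards [Ioi_mem_nhds hx] with y hy using hF y hy
    exact h1.unique h2
  refine ⟨?_, h0⟩
  have h1 : ∫ ξ in (0 : ℝ)..1, C ξ = 0 := by
    rw [intervalIntegral.integral_of_le zero_le_one,
      setIntegral_congr_fun (g := fun _ => 0) measurableSet_Ioc fun ξ hξ => h0 ξ hξ.1]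
    simp
  rw [hF 1 one_pos, sub_eq_zero] at h1
  exact h1.symm

/-- A homogeneous Volterra equation of the second kind has only the zero solution. -/
theorem MemCNegOne.eq_zero_of_eq_lconv {g E : ℝ → ℂ} (hg : MemCNegOne g) (hE : MemCNegOne E)
    (h : ∀ x : ℝ, 0 < x → g x = _root_.lconv g E x) : ∀ x : ℝ, 0 < x → g x = 0 := by
  intro T hT
  obtain ⟨q, hq, hq0, hgb, hEb⟩ := hg.exists_powBound_pair hE
  obtain ⟨B, hB, hbB⟩ := hgb T
  obtain ⟨A, hA, hbA⟩ := hEb T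
  -- With this `r`, convolution with `E` halves the weighted bound, and iterating the equation
  -- forces `g = 0`.
  obtain ⟨r, hr, hrate⟩ := exists_rate_le (A := A) hq (one_half_pos (α := ℝ))
  have key : ∀ n : ℕ, ∀ x ∈ Ioc 0 T,
      ‖g x‖ ≤ B * (1 / 2) ^ n * (Real.exp (r * x) * x ^ q) := by
    intro n
    induction n with
    | zero =>
      intro x hx
      have h1 : 1 ≤ Real.exp (r * x) := Real.one_le_exp (mul_nonneg hr.le hx.1.le)
      have h2 := Real.rpow_nonneg hx.1.le q
      refine (hbB x hx).trans ?_
      rw [pow_zero, mul_one]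
      gcongr
      exact le_mul_of_one_le_left h2 h1
    | succ n ih =>
      intro x hx
      have h2 := Real.rpow_nonneg hx.1.le q
      have hsub : ∀ ξ ∈ Ioo 0 x, ξ ∈ Ioc 0 T := fun ξ hξ => ⟨hξ.1, hξ.2.le.trans hx.2⟩
      rw [h x hx.1]
      refine (norm_lconv_le hq hq0 hr hx.1 (by positivity) (fun ξ hξ => ih ξ (hsub ξ hξ))
        (fun ξ hξ => hbA ξ (hsub ξ hξ))).trans ?_
      calc B * (1 / 2) ^ n * A * convRate q r * (Real.exp (r * x) * x ^ q)
          = B * (1 / 2) ^ n * (A * convRate q r) * (Real.exp (r * x) * x ^ q) := by ring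
        _ ≤ B * (1 / 2) ^ n * (1 / 2) * (Real.exp (r * x) * x ^ q) := by gcongr
        _ = _ := by ring
  have hlim : Filter.Tendsto
      (fun n : ℕ => B * (1 / 2 : ℝ) ^ n * (Real.exp (r * T) * T ^ q)) Filter.atTop (nhds 0) := by
    simpa using ((tendsto_pow_atTop_nhds_zero_of_lt_one (r := (1 / 2 : ℝ)) (by norm_num)
      (by norm_num)).const_mul B).mul_const (Real.exp (r * T) * T ^ q)
  exact norm_le_zero_iff.1 (ge_of_tendsto' hlim fun n => key n T ⟨hT, le_rfl⟩)

/-- If `f^{<n+2>} = 0`, all higher powers vanish, in particular `f^{<2n+2>}`, the convolution square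
of `f^{<n+1>}`. The case of squares lowers the exponent by one. -/
theorem MemCNegOne.eq_zero_of_convPow_eq_zero {f : ℝ → ℂ} (hf : MemCNegOne f) (n : ℕ)
    (h : EqOn (_root_.convPow f (n + 1)) 0 (Ioi 0)) : EqOn f 0 (Ioi 0) := by
  induction n with
  | zero => exact h
  | succ n ih =>
    have hadd : ∀ j, EqOn (_root_.convPow f (n + j + 2)) 0 (Ioi 0) := by
      intro j
      induction j with
      | zero => exact h
      | succ j ihj =>
        intro x hx
        change _root_.lconv (_root_.convPow f (n + j + 2)) f x = 0
        rw [lconv_congr (le_of_lt hx) (ihj.mono Ioo_subset_Ioi_self) (eqOn_refl f _)]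
        simp [_root_.lconv]
    refine ih ((hf.convPow n).eq_zero_of_lconv_self fun x hx => ?_)
    rw [lconv_convPow hf n n hx]
    exact hadd n hx

theorem geomBound_single (n : ℕ) : GeomBound (Pi.single n 1) := by
  refine ⟨1, 1, zero_le_one, one_pos, fun m => ?_⟩
  rcases eq_or_ne m n with rfl | h
  · simp
  · simp [h]

theorem convSeries_single (f : ℝ → ℂ) (n : ℕ) :
    convSeries (Pi.single (n + 1) 1) f = convPow f (n + 1) := by
  ext x
  rw [convSeries, tsum_eq_single n]
  · simp
  · intro m hm
    simp [hm]

/-- The coefficients of a convolution series are determined by its sum. -/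
theorem MemCNegOne.eq_zero_of_convSeries_eq_zero {f : ℝ → ℂ} (hf : MemCNegOne f)
    (hf0 : ∃ x : ℝ, 0 < x ∧ f x ≠ 0) {c : ℕ → ℂ} (hc : GeomBound c)
    (h : ∀ x : ℝ, 0 < x → _root_.convSeries c f x = 0) (n : ℕ) : c (n + 1) = 0 := by
  induction n using Nat.strong_induction_on with
  | _ n ih =>
  by_contra hne
  -- `d` is what remains after dividing out the lowest power `z ^ (n + 1)`.
  set d : ℕ → ℂ := fun k => c (n + 1 + k) with hd
  have hdb : GeomBound d := hc.shift (n + 1)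
  -- Index `0` is left out: `c 0` is arbitrary and does not enter `convSeries`.
  have hcoeff : ∀ k, cauchyCoeff (Pi.single (n + 1) 1) d (k + 1) = c (k + 1) := by
    intro k
    rw [cauchyCoeff]
    rcases lt_or_ge k n with hk | hk
    · rw [ih k hk]
      refine Finset.sum_eq_zero fun m hm => ?_
      have := Finset.mem_range.1 hm
      rw [Pi.single_eq_of_ne (by omega), zero_mul]
    · rw [Finset.sum_eq_single (n + 1)]
      · rw [Pi.single_eq_same, one_mul]
        exact congrArg c (by omega)
      · intro m _ hm
        rw [Pi.single_eq_of_ne hm, zero_mul]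
      · intro hm
        exact absurd (Finset.mem_range.2 (by omega)) hm
  -- Dividing `c (n + 1) f^{<n+1>} + f^{<n+1>} * ∑ d_k f^{<k>} = 0` by `c (n + 1)` gives a Volterra
  -- equation of the second kind.
  have hvolt : ∀ x : ℝ, 0 < x → _root_.convPow f (n + 1) x =
      _root_.lconv (_root_.convPow f (n + 1))
        (fun t => -(c (n + 1))⁻¹ * _root_.convSeries d f t) x := by
    intro x hx
    have h1 := hf.convSeries_cauchyCoeff (geomBound_single (n + 1)) hdb hx
    have h2 : _root_.convSeries (cauchyCoeff (Pi.single (n + 1) 1) d) f x = 0 := by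
      rw [← h x hx]
      simp only [_root_.convSeries, hcoeff]
    rw [h2, convSeries_single, Pi.single_eq_of_ne (by omega), zero_mul, zero_add,
      lconv_comm] at h1
    rw [lconv_const_mul_right, eq_neg_of_add_eq_zero_right h1.symm]
    simp only [hd, add_zero]
    field_simp
  have hzero := (hf.convPow n).eq_zero_of_eq_lconv ((hf.convSeries hdb).const_mul _) hvolt
  obtain ⟨x, hx, hfx⟩ := hf0
  exact hfx (hf.eq_zero_of_convPow_eq_zero n hzero hx)

theorem convSeriesKernel_one_eq_one_iff {f : ℝ → ℂ} (hf : MemCNegOne f)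
    (hf0 : ∃ x : ℝ, 0 < x ∧ f x ≠ 0) {c : ℕ → ℂ} (hc : GeomBound c) :
    convSeriesKernel (fun _ => 1) c f =ᵐ[volume.restrict (Ioi 0)] (fun _ => 1) ↔
      c 0 = 1 ∧ ∀ n : ℕ, 1 ≤ n → c n = 0 := by
  constructor
  · intro h
    have h1 := ((memCNegOne_const 1).convSeriesKernel hf hc).eqOn_of_ae_eq (memCNegOne_const 1) h
    obtain ⟨h2, h3⟩ := (hf.convSeries hc).eq_zero_of_add_integral_const (c := c 0) (d := 1)
      fun x hx => by simpa [convSeriesKernel] using h1 hx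
    refine ⟨h2, fun n hn => ?_⟩
    obtain ⟨m, rfl⟩ := Nat.exists_eq_add_of_le' hn
    exact hf.eq_zero_of_convSeries_eq_zero hf0 hc h3 m
  · rintro ⟨h0, h⟩
    have : convSeries c f = fun _ => 0 := by
      ext x
      simp [convSeries, h]
    refine .of_forall fun x => ?_
    simp [convSeriesKernel, this, h0, lconv]

/-! ### The criterion for Sonin pairs. -/

theorem isSoninPair_convSeriesKernel_iff {κ k f : ℝ → ℂ} {a b : ℕ → ℂ} (h : IsSoninPair κ k)
    (hf : MemCNegOne f) (hf0 : ∃ x : ℝ, 0 < x ∧ f x ≠ 0) (ha : GeomBound a) (hb : GeomBound b) :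
    IsSoninPair (convSeriesKernel κ a f) (convSeriesKernel k b f) ↔
      cauchyCoeff a b 0 = 1 ∧ ∀ n : ℕ, 1 ≤ n → cauchyCoeff a b n = 0 := by
  obtain ⟨hκ, hk, hκk⟩ := h
  rw [locallyIntegrableOn_Ici_iff] at hκ hk
  have hK := hκ.convSeriesKernel (hf.convSeries ha).locInt
  have hK' := hk.convSeriesKernel (hf.convSeries hb).locInt
  have hone : lconv κ k =ᵐ[volume.restrict (Ioi 0)] fun _ => 1 := by
    filter_upwards [hκk] with x hx using hx.2
  have hmul := (lconv_convSeriesKernel hκ hk hf ha hb).trans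
    (convSeriesKernel_congr_ae (f := f) (cauchyCoeff a b) hone)
  rw [← convSeriesKernel_one_eq_one_iff hf hf0 (ha.cauchyCoeff hb), IsSoninPair,
    locallyIntegrableOn_Ici_iff, locallyIntegrableOn_Ici_iff]
  constructor
  · rintro ⟨-, -, h⟩
    refine hmul.symm.trans ?_
    filter_upwards [h] with x hx using hx.2
  · intro h
    refine ⟨hK, hK', ?_⟩
    filter_upwards [hK.ae_lconvExistsAt hK', hmul.trans h] with x h1 h2 using ⟨h1, h2⟩

theorem IsSoninPairCNegOne.isSoninPair {κ k : ℝ → ℂ} (h : IsSoninPairCNegOne κ k) :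
    IsSoninPair κ k := by
  obtain ⟨hκ, hk, h1⟩ := h
  refine ⟨locallyIntegrableOn_Ici_iff.2 hκ.locInt, locallyIntegrableOn_Ici_iff.2 hk.locInt, ?_⟩
  filter_upwards [ae_restrict_mem measurableSet_Ioi] with x hx using h1 x hx

/-- `κ * k` is continuous on `(0,∞)`, so equality with `1` almost everywhere is equality everywhere;
the pointwise theorem thus follows from the almost everywhere one. -/
theorem IsSoninPair.isSoninPairCNegOne {κ k : ℝ → ℂ} (h : IsSoninPair κ k) (hκ : MemCNegOne κ)
    (hk : MemCNegOne k) : IsSoninPairCNegOne κ k := by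
  refine ⟨hκ, hk, fun x hx => ⟨hκ.lconvExistsAt hk hx, ?_⟩⟩
  refine (hκ.lconv hk).eqOn_of_ae_eq (memCNegOne_const 1) ?_ hx
  filter_upwards [h.2.2] with y hy using hy.2

theorem cauchyCoeff_zero (a b : ℕ → ℂ) : cauchyCoeff a b 0 = a 0 * b 0 := by
  simp [cauchyCoeff]

theorem theorem1 (κ₁ k₁ f : ℝ → ℂ) (a b : ℕ → ℂ)
    (hf : MemCNegOne f) (hf0 : ∃ x : ℝ, 0 < x ∧ f x ≠ 0)
    (ha : 0 < (FormalMultilinearSeries.ofScalars ℂ a).radius)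
    (hb : 0 < (FormalMultilinearSeries.ofScalars ℂ b).radius) :
    -- the two convolution series converge at every point of `(0,∞)`
    (∀ x : ℝ, 0 < x →
      Summable (fun n : ℕ => a (n + 1) * convPow f (n + 1) x) ∧
      Summable (fun n : ℕ => b (n + 1) * convPow f (n + 1) x)) ∧
    -- locally integrable Sonin kernels
    (IsSoninPair κ₁ k₁ →
      (∀ᵐ x ∂(volume.restrict (Ioi (0 : ℝ))),
        LconvExistsAt κ₁ (convSeries a f) x ∧ LconvExistsAt k₁ (convSeries b f) x) ∧
      (IsSoninPair (convSeriesKernel κ₁ a f) (convSeriesKernel k₁ b f) ↔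
        a 0 * b 0 = 1 ∧
          ∀ n : ℕ, 1 ≤ n → ∑ m ∈ Finset.range (n + 1), a m * b (n - m) = 0)) ∧
    -- Sonin kernels in `C₋₁(0,∞)`, with all identities holding pointwise everywhere
    (IsSoninPairCNegOne κ₁ k₁ →
      (∀ x : ℝ, 0 < x →
        LconvExistsAt κ₁ (convSeries a f) x ∧ LconvExistsAt k₁ (convSeries b f) x) ∧
      (IsSoninPairCNegOne (convSeriesKernel κ₁ a f) (convSeriesKernel k₁ b f) ↔
        a 0 * b 0 = 1 ∧
          ∀ n : ℕ, 1 ≤ n → ∑ m ∈ Finset.range (n + 1), a m * b (n - m) = 0)) := by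
  have ha := geomBound_of_radius_pos ha
  have hb := geomBound_of_radius_pos hb
  have hA := hf.convSeries ha
  have hB := hf.convSeries hb
  refine ⟨fun x hx => ⟨(hf.summable_norm_convSeries ha hx).of_norm,
    (hf.summable_norm_convSeries hb hx).of_norm⟩, fun h => ⟨?_, ?_⟩, fun h => ⟨?_, ?_⟩⟩
  · have hκ := locallyIntegrableOn_Ici_iff.1 h.1
    have hk := locallyIntegrableOn_Ici_iff.1 h.2.1
    exact (hκ.ae_lconvExistsAt hA.locInt).and (hk.ae_lconvExistsAt hB.locInt)
  · rw [← cauchyCoeff_zero]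
    exact isSoninPair_convSeriesKernel_iff h hf hf0 ha hb
  · exact fun x hx => ⟨h.1.lconvExistsAt hA hx, h.2.1.lconvExistsAt hB hx⟩
  · rw [← cauchyCoeff_zero]
    refine Iff.trans ⟨fun h' => h'.isSoninPair, fun h' => h'.isSoninPairCNegOne ?_ ?_⟩
      (isSoninPair_convSeriesKernel_iff h.isSoninPair hf hf0 ha hb)
    · exact h.1.convSeriesKernel hf ha
    · exact h.2.1.convSeriesKernel hf hb
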